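/- **Setting.** All logarithms are to base 2, and $\log^{\ast} n$ is the least $i\ge 0$ such that the $i$-fold iterated logarithm of $n$ is at most $1$. For a finite binary tree $T$ let $s(x)$ be the number of nodes in the subtree rooted at $x$, let $p(x)$ be the parent of $x$, and let $$\Phi(T)=\sum_{x}\frac{H(x)}{\bigl(\log(2+H(x))\bigr)^{2}},\qquad H(x)=\log\frac{s(p(x))}{s(x)},$$ where the sum is over all nodes $x$ of $T$ except its root. A *monotone path* $\mathcal P$ of length $k$ in $T$ consists of $k$ nodes $x_1,\dots,x_k$, starting at an arbitrary node $x_1$ of $T$, such that each $x_{i+1}$ is the right child of $x_i$ (or each $x_{i+1}$ is the left child of $x_i$); $x_k$ need not be a leaf. A *pairing round* with $m$ rotations on a monotone path $y_1,y_2,\dots$ rotates the edges $y_1y_2,\ y_3y_4,\dots,\ y_{2m-1}y_{2m}$, which pushes $y_1,y_3,\dots,y_{2m-1}$ off the path. The *multipass transformation* of $\mathcal P$ first performs a pairing round with the smallest number of rotations that makes the length of the path equal to $2^j-1$ for some integer $j$, and then, on what remains of the path, successive pairing rounds with $2^{j-1}-1,\ 2^{j-2}-1,\ \dots,\ 2^{0}-1$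 rotations. **Theorem 3.** There is an absolute constant $C$ such that the following holds for every binary tree $T$ (in particular for every binary search tree), every monotone path $\mathcal P$ of length $k$ in $T$, and the number $n$ of nodes in the subtree rooted at the first node of $\mathcal P$, if $n\ge 2$. Let $T'$ be the tree obtained from $T$ by the multipass transformation of $\mathcal P$. 1. If every node of $\mathcal P$ other than the last one has a nonempty subtree hanging off the path (that is, has two children), then $$\Phi(T')-\Phi(T)\ \le\ -\frac{k}{2^{\log^{\ast} n}}+C\cdot\log n\cdot\log^{\ast} n .$$ 2. Without any assumption on the hanging subtrees, the same bound, with the same $k$ and $n$, holds for $\Phi(\overline{T'})-\Phi(\overline{T})$, where $\overline{T}$ is obtained from $T$ by attaching an additional leaf in place of every empty subtree, so that in $\Phi$ an empty subtree counts as a subtree of size $1$. -/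

import Mathlib

namespace Multipass

/-- The iterated logarithm `log* x` to base `2`: the least number of applications of `log₂` that
bring `x` to a value at most `1`. -/
noncomputable def logStar (x : ℝ) : ℕ :=
  sInf {i : ℕ | (Real.logb 2)^[i] x ≤ 1}

/-- The two kinds of child pointers of a binary tree. -/
inductive Dir where
  | left : Dir
  | right : Dir

/-- The opposite direction. -/
def Dir.opp : Dir → Dir
  | .left => .right
  | .right => .left

/-! ### The potential

The size `s(x)` of the subtree rooted at `x` is its number of nodes, `BinaryTree.numNodes`. -/

/-- The potential `φ(x) = H / log₂² (2 + H)`, with `H = log₂ (p / s)`, of a node `x` with subtree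
size `s` whose parent has subtree size `p`. -/
noncomputable def nodePotential (p s : ℕ) : ℝ :=
  Real.logb 2 ((p : ℝ) / s) / Real.logb 2 (2 + Real.logb 2 ((p : ℝ) / s)) ^ 2

/-- The sum of the potentials of all nodes of a tree whose root hangs from a parent with subtree
size `p`. -/
noncomputable def potentialBelow {α : Type*} (p : ℕ) : BinaryTree α → ℝ
  | .nil => 0
  | .node a l r =>
      nodePotential p (BinaryTree.node a l r).numNodes
        + potentialBelow (BinaryTree.node a l r).numNodes l
        + potentialBelow (BinaryTree.node a l r).numNodes r

/-- The potential `Φ` of a whole tree: the sum of `φ(x)` over all nodes `x` that have a parent.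
(The root has none, and contributes `0`.) -/
noncomputable def potential {α : Type*} : BinaryTree α → ℝ
  | .nil => 0
  | .node a l r =>
      potentialBelow (BinaryTree.node a l r).numNodes l
        + potentialBelow (BinaryTree.node a l r).numNodes r

/-- The tree in which every empty subtree is replaced by an additional leaf node, so that null
pointers count as subtrees of size `1`. -/
def complete {α : Type*} : BinaryTree α → BinaryTree (Option α)
  | .nil => .node none .nil .nil
  | .node a l r => .node (some a) (complete l) (complete r)

/-! ### Positions and monotone paths -/

/-- The subtree reached from the root by following the given child pointers (`nil` if there is
none). -/
def subtreeAt {α : Type*} : BinaryTree α → List Dir → BinaryTree α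
  | t, [] => t
  | .nil, _ :: _ => .nil
  | .node _ l _, .left :: p => subtreeAt l p
  | .node _ _ r, .right :: p => subtreeAt r p

/-- Replace the subtree at the given position by its image under `f`. -/
def modifyAt {α : Type*} (f : BinaryTree α → BinaryTree α) :
    BinaryTree α → List Dir → BinaryTree α
  | t, [] => f t
  | .nil, _ :: _ => .nil
  | .node a l r, .left :: p => .node a (modifyAt f l p) r
  | .node a l r, .right :: p => .node a l (modifyAt f r p)

/-- The position of the `i`-th node (from `i = 0`) of the path that starts at position `q` and
follows pointers in direction `d`. -/
def pathPos (q : List Dir) (d : Dir) (i : ℕ) : List Dir :=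
  q ++ List.replicate i d

/-- The tree `t` contains a monotone path with `k` nodes, starting at position `q` and following
child pointers in direction `d` only. The last node of the path need not be a leaf. -/
def IsMonotonePath {α : Type*} (t : BinaryTree α) (q : List Dir) (d : Dir) (k : ℕ) : Prop :=
  ∀ i < k, subtreeAt t (pathPos q d i) ≠ .nil

/-! ### The multipass transformation -/

/-- The rotation of the edge between the root and its child in direction `d`. -/
def rotate {α : Type*} : Dir → BinaryTree α → BinaryTree α
  | .right, .node x A (.node y B C) => .node y (.node x A B) C
  | .left, .node x (.node y C B) A => .node y C (.node x B A)
  | _, t => t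

/-- Apply `f` to the child of the root in direction `d`. -/
def modifyChild {α : Type*} (f : BinaryTree α → BinaryTree α) :
    Dir → BinaryTree α → BinaryTree α
  | _, .nil => .nil
  | .left, .node a l r => .node a (f l) r
  | .right, .node a l r => .node a l (f r)

/-- A pairing round with `m` rotations on the path from the root in direction `d`: for the path
`x₁, x₂, x₃, …` the edges `x₁x₂`, `x₃x₄`, …, `x₂ₘ₋₁x₂ₘ` are rotated, which pushes
`x₁, x₃, …, x₂ₘ₋₁` off the path. -/
def pairingRound {α : Type*} (d : Dir) : ℕ → BinaryTree α → BinaryTree α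
  | 0, t => t
  | m + 1, t => modifyChild (pairingRound d m) d (rotate d t)

/-- Successive pairing rounds with `2 ^ (j - 1) - 1`, `2 ^ (j - 2) - 1`, …, `2 ^ 0 - 1`
rotations. -/
def laterRounds {α : Type*} (d : Dir) : ℕ → BinaryTree α → BinaryTree α
  | 0, t => t
  | j + 1, t => laterRounds d j (pairingRound d (2 ^ j - 1) t)

/-- The multipass transformation of the path with `k` nodes that starts at the root and follows
direction `d`. The first round makes just enough rotations, `k - (2 ^ j - 1)`, for the path length
to become `2 ^ j - 1`, where `j = ⌊log₂ (k + 1)⌋`, i.e. `2 ^ j - 1` is the largest number of this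
form that is at most `k`; the later rounds make `2 ^ (j - 1) - 1`, `2 ^ (j - 2) - 1`, …
rotations. -/
def multipass {α : Type*} (d : Dir) (k : ℕ) (t : BinaryTree α) : BinaryTree α :=
  laterRounds d (Nat.log 2 (k + 1)) (pairingRound d (k - (2 ^ Nat.log 2 (k + 1) - 1)) t)

end Multipass

open Multipass

/-! Consider a rotation whose two nodes carry hanging subtrees of sizes `a`, `b` above a rest of
size `c`, and put `s = a + b + c + 2`. Let `u`, `v` be the height differences of the two hanging
subtrees below their new common parent, `H` that of this parent, and `z = log (s / (b + c + 1))`.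
Subadditivity of `phi` bounds the change by `linkCost u v H + phi z`. If `v` belongs to the larger
subtree, then `v ≤ 2` and `v ≤ 9 * 2 ^ (-u)`, while `phi (u + H) - phi u ≥ H / (10 log² (2 + u +
H))`. Two facts follow.

Upper bound (`exists_linkDelta_le`): a rotation costs at most a constant times the drop of the level
`log (size + 1)` along the path. The drops telescope, so a round costs `O(log n)`.

Gain (`exists_linkDelta_gain`): if both hanging subtrees have height difference at most `t`, then,
up to a level drop, either the rotation gains `K`, or the new hanging subtree has height difference
`O(log² (4 + t))`.

Iterating `t ↦ 40 log² (4 + t)` takes `log n` to a constant in `log* n` steps. A window of `log* n`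
rounds is therefore amortized by the number of hanging subtrees above the current threshold. This
number is 0 at the start, and at the end it counts all but `O(log n)` subtrees, because a subtree of
bounded height difference forces a constant level drop. With `K = 2` the window gains twice the
number of nodes left, about `k / 2 ^ log* n`, up to `O(log n · log* n)`.

The remaining rounds must not lose this gain. While the path is long, further windows do not
increase the potential. Then `O(log* n)` rounds at `O(log n)` each shorten it to `log n` nodes, and
from there the round costs form a convergent series (`laterCost_le_of_two_pow_le`). -/

namespace Multipass

/-! ### The function `H ↦ H / log₂² (2 + H)` -/

/-- The potential of a node as a function of its height difference `H`. -/
noncomputable def phi (H : ℝ) : ℝ := H / Real.logb 2 (2 + H) ^ 2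

@[simp] lemma phi_zero : phi 0 = 0 := by simp [phi]

-- Division by zero and `logb 2 0 = 0` make an empty subtree contribute nothing, as the potential
-- without added leaves requires.
@[simp] lemma nodePotential_zero_right (p : ℕ) : nodePotential p 0 = 0 := by
  simp [nodePotential]

lemma one_le_logb_two_add {H : ℝ} (h : 0 ≤ H) : 1 ≤ Real.logb 2 (2 + H) := by
  rw [Real.le_logb_iff_rpow_le (by norm_num) (by linarith)]
  simpa using h

lemma logb_two_mono {x y : ℝ} (hx : 0 < x) (h : x ≤ y) : Real.logb 2 x ≤ Real.logb 2 y :=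
  Real.logb_le_logb_of_le (by norm_num) hx h

lemma phi_nonneg {H : ℝ} (h : 0 ≤ H) : 0 ≤ phi H := div_nonneg h (sq_nonneg _)

lemma phi_le_self {H : ℝ} (h : 0 ≤ H) : phi H ≤ H :=
  div_le_self h (one_le_pow₀ (one_le_logb_two_add h))

lemma inv_sq_logb_anti {x y : ℝ} (hx : 0 ≤ x) (h : x ≤ y) :
    1 / Real.logb 2 (2 + y) ^ 2 ≤ 1 / Real.logb 2 (2 + x) ^ 2 := by
  have h1 := one_le_logb_two_add hx
  have h2 : Real.logb 2 (2 + x) ≤ Real.logb 2 (2 + y) :=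
    logb_two_mono (by linarith) (by linarith)
  have : 0 < Real.logb 2 (2 + x) := by linarith
  gcongr

lemma phi_add_le {x y : ℝ} (hx : 0 ≤ x) (hy : 0 ≤ y) : phi (x + y) ≤ phi x + phi y := by
  have h1 := mul_le_mul_of_nonneg_left (inv_sq_logb_anti hx (le_add_of_nonneg_right hy)) hx
  have h2 := mul_le_mul_of_nonneg_left (inv_sq_logb_anti hy (le_add_of_nonneg_left hx)) hy
  have : phi (x + y) = x * (1 / Real.logb 2 (2 + (x + y)) ^ 2)
      + y * (1 / Real.logb 2 (2 + (x + y)) ^ 2) := by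
    unfold phi; ring
  rw [this]
  calc _ ≤ _ := add_le_add h1 h2
    _ = _ := by unfold phi; ring

lemma log_four_lower : (1.386 : ℝ) ≤ Real.log 4 := by
  have : Real.log 4 = 2 * Real.log 2 := by
    rw [show (4 : ℝ) = 2 ^ 2 by norm_num, Real.log_pow]; norm_num
  have := Real.log_two_gt_d9
  linarith

lemma two_mul_sub_le_mul_log {z : ℝ} (hz : 2 ≤ z) : 2 * (z - 2) ≤ 9 / 10 * (z * Real.log z) := by
  have h0 : 0 < z := by linarith
  -- Tangent bound for the logarithm at `z = 4`.
  have h1 := Real.one_sub_inv_le_log_of_pos (x := z / 4) (by positivity)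
  rw [Real.log_div h0.ne' (by norm_num)] at h1
  have h2 : z * (1 - (z / 4)⁻¹) ≤ z * (Real.log z - Real.log 4) :=
    mul_le_mul_of_nonneg_left h1 h0.le
  have h3 : z * (1 - (z / 4)⁻¹) = z - 4 := by field_simp
  nlinarith [log_four_lower]

lemma phi_hasDerivAt {x : ℝ} (hx : 0 ≤ x) :
    HasDerivAt phi ((1 - 2 * x / ((2 + x) * Real.log (2 + x))) / Real.logb 2 (2 + x) ^ 2) x := by
  have h2 : (2 + x) ≠ 0 := by linarith
  have hl : Real.log (2 + x) ≠ 0 := (Real.log_pos (by linarith)).ne'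
  have hl2 : Real.log 2 ≠ 0 := (Real.log_pos (by norm_num)).ne'
  have h3 : HasDerivAt (fun x : ℝ => Real.logb 2 (2 + x)) (1 / (2 + x) / Real.log 2) x :=
    (((hasDerivAt_id x).const_add 2).log h2).div_const (Real.log 2)
  have hb : Real.logb 2 (2 + x) ≠ 0 := by have := one_le_logb_two_add hx; linarith
  have key := (hasDerivAt_id x).div (h3.pow 2) (pow_ne_zero 2 hb)
  refine (key.congr_deriv ?_ : HasDerivAt phi _ x)
  simp only [Real.logb, id, Pi.pow_apply]
  field_simp
  norm_num
  field_simp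

/-- The bound of `two_mul_sub_le_mul_log` keeps the derivative of `phi` above `1 / (10 log² (2 +
x))`; the mean value inequality finishes. -/
lemma phi_increment {u H : ℝ} (hu : 0 ≤ u) (hH : 0 ≤ H) :
    H / (10 * Real.logb 2 (2 + (u + H)) ^ 2) ≤ phi (u + H) - phi u := by
  have key := Convex.mul_sub_le_image_sub_of_le_deriv (convex_Icc u (u + H)) (f := phi)
    (C := 1 / (10 * Real.logb 2 (2 + (u + H)) ^ 2))
    (fun x hx => (phi_hasDerivAt (hu.trans hx.1)).continuousAt.continuousWithinAt)
    (fun x hx => by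
      rw [interior_Icc] at hx
      exact (phi_hasDerivAt (hu.trans hx.1.le)).differentiableAt.differentiableWithinAt)
    (fun x hx => by
      rw [interior_Icc] at hx
      have hx0 : 0 ≤ x := hu.trans hx.1.le
      rw [(phi_hasDerivAt hx0).deriv]
      have h1 := inv_sq_logb_anti hx0 hx.2.le
      have h2 := two_mul_sub_le_mul_log (z := 2 + x) (by linarith)
      have hl : 0 < (2 + x) * Real.log (2 + x) :=
        mul_pos (by linarith) (Real.log_pos (by linarith))
      have h3 : 1 / 10 ≤ 1 - 2 * x / ((2 + x) * Real.log (2 + x)) := by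
        have : 2 * x / ((2 + x) * Real.log (2 + x)) ≤ 9 / 10 := by
          rw [div_le_iff₀ hl]; linarith
        linarith
      have h4 : 0 ≤ 1 / Real.logb 2 (2 + x) ^ 2 := by positivity
      calc 1 / (10 * Real.logb 2 (2 + (u + H)) ^ 2)
          = 1 / 10 * (1 / Real.logb 2 (2 + (u + H)) ^ 2) := by ring
        _ ≤ 1 / 10 * (1 / Real.logb 2 (2 + x) ^ 2) := by linarith
        _ ≤ (1 - 2 * x / ((2 + x) * Real.log (2 + x))) * (1 / Real.logb 2 (2 + x) ^ 2) :=
          mul_le_mul_of_nonneg_right h3 h4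
        _ = _ := by ring)
    u ⟨le_rfl, by linarith⟩ (u + H) ⟨by linarith, le_rfl⟩ (by linarith)
  calc _ = 1 / (10 * Real.logb 2 (2 + (u + H)) ^ 2) * (u + H - u) := by ring
    _ ≤ _ := key

lemma phi_mono {x y : ℝ} (hx : 0 ≤ x) (h : x ≤ y) : phi x ≤ phi y := by
  have := phi_increment hx (sub_nonneg.2 h)
  rw [add_sub_cancel] at this
  have h2 : 0 ≤ (y - x) / (10 * Real.logb 2 (2 + y) ^ 2) :=
    div_nonneg (sub_nonneg.2 h) (by positivity)
  linarith

/-- A chord bound that replaces the concavity of `phi`. -/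
lemma phi_le_chord {z τ : ℝ} (hz : 0 ≤ z) (hτ : 0 ≤ τ) :
    phi z ≤ (τ + z) / Real.logb 2 (2 + τ) ^ 2 := by
  rcases le_total τ z with h | h
  · have h1 := mul_le_mul_of_nonneg_left (inv_sq_logb_anti hτ h) hz
    have h2 : 0 ≤ τ / Real.logb 2 (2 + τ) ^ 2 := phi_nonneg hτ
    calc phi z = z * (1 / Real.logb 2 (2 + z) ^ 2) := by unfold phi; ring
      _ ≤ z * (1 / Real.logb 2 (2 + τ) ^ 2) := h1
      _ ≤ τ / Real.logb 2 (2 + τ) ^ 2 + z * (1 / Real.logb 2 (2 + τ) ^ 2) := by linarith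
      _ = _ := by ring
  · have h1 : phi τ = τ / Real.logb 2 (2 + τ) ^ 2 := rfl
    have h2 := phi_mono hz h
    rw [h1] at h2
    refine h2.trans ?_
    gcongr
    linarith

/-! ### The gain of a rotation, as a function of the three height differences -/

/-- The change of the potentials of two hanging subtrees and of the node that joins them. -/
noncomputable def linkCost (u v H : ℝ) : ℝ := phi u - phi (u + H) + (phi v - phi (v + H)) + phi H

lemma linkCost_comm (u v H : ℝ) : linkCost u v H = linkCost v u H := by
  unfold linkCost; ring

/-- The new edge is paid for by the second subtree, as `phi H ≤ phi (v + H)`; the increment of `phi`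
at the first one remains as gain. -/
lemma linkCost_le {u v H : ℝ} (hu : 0 ≤ u) (hv : 0 ≤ v) (hH : 0 ≤ H) :
    linkCost u v H ≤ v - H / (10 * Real.logb 2 (2 + (u + H)) ^ 2) := by
  have h1 := phi_increment hu hH
  have h2 : phi H ≤ phi (v + H) := phi_mono hH (by linarith)
  have h3 := phi_le_self hv
  unfold linkCost; linarith

lemma linkCost_le_of_le {u v H : ℝ} (hu : 0 ≤ u) (hv : 0 ≤ v) (hH : 0 ≤ H) :
    linkCost u v H ≤ v :=
  (linkCost_le hu hv hH).trans (sub_le_self _ (div_nonneg hH (by positivity)))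

lemma one_add_sq_le_two_rpow {u : ℝ} (hu : 0 ≤ u) : (1 + u) ^ 2 ≤ 5 * (2 : ℝ) ^ u := by
  have h1 : 1 + u * Real.log 2 + (u * Real.log 2) ^ 2 / 2 ≤ Real.exp (u * Real.log 2) :=
    Real.quadratic_le_exp_of_nonneg (mul_nonneg hu (Real.log_nonneg (by norm_num)))
  have h2 : (2 : ℝ) ^ u = Real.exp (u * Real.log 2) := by
    rw [Real.rpow_def_of_pos (by norm_num), mul_comm]
  have h3 := Real.log_two_gt_d9
  rw [h2]
  have h4 : 0.69 * u ≤ u * Real.log 2 := by nlinarith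
  nlinarith [mul_nonneg hu hu]

lemma exists_linkCost_nonpos : ∃ c₁ : ℝ, 0 ≤ c₁ ∧ ∀ u v H : ℝ, 0 ≤ u → 0 ≤ v →
    v ≤ 9 * (2 : ℝ) ^ (-u) → c₁ ≤ H → linkCost u v H ≤ 0 := by
  -- The logarithm at `H = 200000` is at most `18 (1 + u)`, and `9 * 10 * 324 * 5 = 145800` must not
  -- exceed this `H`. Monotonicity of `phi` covers larger `H`.
  refine ⟨200000, by norm_num, fun u v H hu hv hvu hH => ?_⟩
  have h1 := phi_increment hu (show (0 : ℝ) ≤ 200000 by norm_num)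
  have h2 : phi H ≤ phi (v + H) := phi_mono (by linarith) (by linarith)
  have h3 := phi_le_self hv
  have h4 : phi (u + 200000) ≤ phi (u + H) := phi_mono (by linarith) (by linarith)
  have h5 : Real.logb 2 (2 + (u + 200000)) ≤ 18 * (1 + u) := by
    rw [Real.logb_le_iff_le_rpow (by norm_num) (by linarith)]
    have e1 : (2 : ℝ) ^ (18 * (1 + u)) = 2 ^ (18 : ℝ) * 2 ^ (18 * u) := by
      rw [← Real.rpow_add (by norm_num)]; ring_nf
    have e2 : (2 : ℝ) ^ (18 : ℝ) = 262144 := by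
      rw [show (18 : ℝ) = ((18 : ℕ) : ℝ) by norm_num, Real.rpow_natCast]; norm_num
    have e3 : 1 + (18 * u) * Real.log 2 ≤ (2 : ℝ) ^ (18 * u) := by
      rw [Real.rpow_def_of_pos (by norm_num)]
      have := Real.add_one_le_exp (Real.log 2 * (18 * u))
      linarith
    have e4 := Real.log_two_gt_d9
    rw [e1, e2]
    nlinarith
  have h6 : 1 ≤ Real.logb 2 (2 + (u + 200000)) := one_le_logb_two_add (by linarith)
  have h7 : Real.logb 2 (2 + (u + 200000)) ^ 2 ≤ 324 * (5 * (2 : ℝ) ^ u) := by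
    calc _ ≤ (18 * (1 + u)) ^ 2 := by gcongr
      _ = 324 * (1 + u) ^ 2 := by ring
      _ ≤ _ := by linarith [one_add_sq_le_two_rpow hu]
  have h8 : 9 * (2 : ℝ) ^ (-u) ≤ 200000 / (10 * Real.logb 2 (2 + (u + 200000)) ^ 2) := by
    rw [le_div_iff₀ (by positivity), Real.rpow_neg (by norm_num)]
    have hp : (0 : ℝ) < 2 ^ u := by positivity
    calc 9 * ((2 : ℝ) ^ u)⁻¹ * (10 * Real.logb 2 (2 + (u + 200000)) ^ 2)
        ≤ 9 * ((2 : ℝ) ^ u)⁻¹ * (10 * (324 * (5 * (2 : ℝ) ^ u))) := by gcongr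
      _ = 145800 := by field_simp; norm_num
      _ ≤ _ := by norm_num
  unfold linkCost
  linarith

/-! ### A single rotation -/

/-- The height difference `log₂ (p / s)` between a node of size `s` and its parent of size `p`. -/
noncomputable def heightDiff (p s : ℕ) : ℝ := Real.logb 2 ((p : ℝ) / s)

/-- The logarithm `log₂ (c + 1)`, which is also meaningful for the empty tree. -/
noncomputable def level (c : ℕ) : ℝ := Real.logb 2 ((c : ℝ) + 1)

lemma level_nonneg (c : ℕ) : 0 ≤ level c :=
  Real.logb_nonneg (by norm_num) (by linarith [c.cast_nonneg (α := ℝ)])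

lemma level_mono {c d : ℕ} (h : c ≤ d) : level c ≤ level d :=
  logb_two_mono (by positivity) (by exact_mod_cast Nat.succ_le_succ h)

lemma heightDiff_nonneg {p s : ℕ} (hs : 0 < s) (h : s ≤ p) : 0 ≤ heightDiff p s := by
  have : (0 : ℝ) < s := by exact_mod_cast hs
  refine Real.logb_nonneg (by norm_num) ?_
  rw [le_div_iff₀ this]
  simpa using (by exact_mod_cast h : (s : ℝ) ≤ p)

lemma heightDiff_add {p r s : ℕ} (hp : 0 < p) (hr : 0 < r) (hs : 0 < s) :
    heightDiff p r + heightDiff r s = heightDiff p s := by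
  have : (0 : ℝ) < p := by exact_mod_cast hp
  have : (0 : ℝ) < r := by exact_mod_cast hr
  have : (0 : ℝ) < s := by exact_mod_cast hs
  unfold heightDiff
  rw [← Real.logb_mul (by positivity) (by positivity)]
  congr 1
  field_simp

lemma nodePotential_eq_phi (p s : ℕ) : nodePotential p s = phi (heightDiff p s) := rfl

lemma nodePotential_mono_left {p r s : ℕ} (hr : 0 < r) (h : r ≤ p) (hs : s ≤ r) :
    nodePotential r s ≤ nodePotential p s := by
  rcases Nat.eq_zero_or_pos s with rfl | h0
  · simp
  rw [nodePotential_eq_phi, nodePotential_eq_phi, ← heightDiff_add (hr.trans_le h) hr h0]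
  exact phi_mono (heightDiff_nonneg h0 hs) (by linarith [heightDiff_nonneg hr h])

lemma nodePotential_le_add {p r s : ℕ} (hr : 0 < r) (h : r ≤ p) (hs : s ≤ r) :
    nodePotential p s ≤ phi (heightDiff p r) + nodePotential r s := by
  rcases Nat.eq_zero_or_pos s with rfl | h0
  · simpa using phi_nonneg (heightDiff_nonneg hr h)
  rw [nodePotential_eq_phi, nodePotential_eq_phi, ← heightDiff_add (hr.trans_le h) hr h0]
  exact phi_add_le (heightDiff_nonneg hr h) (heightDiff_nonneg h0 hs)

/-- The change of the potential by the rotation of the edge between a node and its child, where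
`a` and `b` are the sizes of the subtrees that hang off these two nodes and `c` is the size of the
subtree below them. -/
noncomputable def linkDelta (a b c : ℕ) : ℝ :=
  nodePotential (a + b + 1) a + nodePotential (a + b + 1) b
    + nodePotential (a + b + c + 2) (a + b + 1) + nodePotential (a + b + c + 2) c
    - (nodePotential (a + b + c + 2) a + nodePotential (a + b + c + 2) (b + c + 1)
      + nodePotential (b + c + 1) b + nodePotential (b + c + 1) c)

/-- The old height difference of `b` is `v + H - z`, so subadditivity loses `phi z` there. It loses
another `phi z` at `c`, which the old potential of the second path node cancels. -/
lemma linkDelta_le_linkCost {a b : ℕ} (c : ℕ) (ha : 0 < a) (hb : 0 < b) :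
    linkDelta a b c ≤ linkCost (heightDiff (a + b + 1) a) (heightDiff (a + b + 1) b)
      (heightDiff (a + b + c + 2) (a + b + 1)) + phi (heightDiff (a + b + c + 2) (b + c + 1)) := by
  have h1 := nodePotential_le_add (p := a + b + c + 2) (r := b + c + 1) (s := c)
    (by omega) (by omega) (by omega)
  have h2 := nodePotential_le_add (p := a + b + c + 2) (r := b + c + 1) (s := b)
    (by omega) (by omega) (by omega)
  have h3 := heightDiff_add (p := a + b + c + 2) (r := a + b + 1) (s := a)
    (by omega) (by omega) (by omega)
  have h4 := heightDiff_add (p := a + b + c + 2) (r := a + b + 1) (s := b)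
    (by omega) (by omega) (by omega)
  unfold linkCost linkDelta
  rw [add_comm (heightDiff (a + b + 1) a), h3, add_comm (heightDiff (a + b + 1) b), h4]
  simp only [nodePotential_eq_phi] at *
  linarith

/-- Empty subtrees have potential 0, so only the potential of the node pushed off the path can add
to the total, and it is at most the logarithm of the total size. -/
lemma linkDelta_zero_right_le (a c : ℕ) : linkDelta a 0 c ≤ level (a + c + 2) := by
  have h1 := nodePotential_le_add (p := a + 0 + c + 2) (r := 0 + c + 1) (s := c)
    (by omega) (by omega) (by omega)
  have h2 := nodePotential_mono_left (p := a + 0 + c + 2) (r := a + 0 + 1) (s := a)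
    (by omega) (by omega) (by omega)
  have h3 : nodePotential (a + 0 + c + 2) (a + 0 + 1) ≤ level (a + c + 2) := by
    rw [nodePotential_eq_phi]
    refine (phi_le_self (heightDiff_nonneg (by omega) (by omega))).trans ?_
    refine logb_two_mono (by positivity) ?_
    push_cast
    rw [div_le_iff₀ (by positivity)]
    have := a.cast_nonneg (α := ℝ)
    have := c.cast_nonneg (α := ℝ)
    nlinarith
  unfold linkDelta
  simp only [nodePotential_zero_right]
  simp only [nodePotential_eq_phi] at *
  linarith

/-- This turns `phi z` into a level difference, which telescopes along the path. -/
lemma heightDiff_le_level_sub (a b c : ℕ) :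
    heightDiff (a + b + c + 2) (b + c + 1) ≤ level (a + b + c + 2) - level c := by
  unfold heightDiff level
  rw [← Real.logb_div (by positivity) (by positivity)]
  refine logb_two_mono (by positivity) ?_
  push_cast
  have := a.cast_nonneg (α := ℝ)
  have := b.cast_nonneg (α := ℝ)
  have := c.cast_nonneg (α := ℝ)
  rw [div_le_div_iff₀ (by positivity) (by positivity)]
  nlinarith [mul_nonneg ‹0 ≤ (a : ℝ)› ‹0 ≤ (b : ℝ)›, mul_nonneg ‹0 ≤ (b : ℝ)› ‹0 ≤ (b : ℝ)›,
    mul_nonneg ‹0 ≤ (b : ℝ)› ‹0 ≤ (c : ℝ)›]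

/-- If a fixed fraction of a subtree lies outside its subtree of size `c`, the level drops. -/
lemma rpow_neg_le_level_sub {s x c : ℕ} {t : ℝ} (hx : 0 < x) (hs : x + c + 1 ≤ s)
    (h : heightDiff s x ≤ t) : (2 : ℝ) ^ (-t) ≤ level s - level c := by
  have hx' : (0 : ℝ) < x := by exact_mod_cast hx
  have hs' : (x : ℝ) + c + 1 ≤ s := by exact_mod_cast hs
  have hc := c.cast_nonneg (α := ℝ)
  have hs0 : (0 : ℝ) < s := by linarith
  unfold heightDiff at h
  rw [Real.logb_le_iff_le_rpow (by norm_num) (by positivity), div_le_iff₀ hx'] at h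
  have h1 : (2 : ℝ) ^ (-t) * s ≤ x := by
    rw [Real.rpow_neg (by norm_num), inv_mul_le_iff₀ (by positivity)]; exact h
  unfold level
  rw [← Real.logb_div (by positivity) (by positivity)]
  have h2 := Real.one_sub_inv_le_log_of_pos (x := ((s : ℝ) + 1) / (c + 1)) (by positivity)
  have h3 : (2 : ℝ) ^ (-t) ≤ 1 - (((s : ℝ) + 1) / (c + 1))⁻¹ := by
    rw [inv_div, le_sub_iff_add_le, ← le_sub_iff_add_le', div_le_iff₀ (by positivity)]
    have h4 : (2 : ℝ) ^ (-t) ≤ 1 := by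
      by_contra! h5
      nlinarith
    nlinarith
  have h5 : Real.log (((s : ℝ) + 1) / (c + 1)) ≤ Real.logb 2 (((s : ℝ) + 1) / (c + 1)) := by
    have h6 : 0 ≤ Real.log (((s : ℝ) + 1) / (c + 1)) := by
      have : 0 < (2 : ℝ) ^ (-t) := by positivity
      linarith
    unfold Real.logb
    rw [le_div_iff₀ (Real.log_pos (by norm_num))]
    have := Real.log_two_lt_d9
    nlinarith
  linarith

lemma heightDiff_larger {a b : ℕ} (ha : 0 < a) (h : a ≤ b) :
    heightDiff (a + b + 1) b ≤ 2 ∧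
      heightDiff (a + b + 1) b ≤ 9 * (2 : ℝ) ^ (-heightDiff (a + b + 1) a) := by
  have ha' : (1 : ℝ) ≤ a := by exact_mod_cast ha
  have h' : (a : ℝ) ≤ b := by exact_mod_cast h
  have hb : (0 : ℝ) < b := by linarith
  have e : (2 : ℝ) ^ (-heightDiff (a + b + 1) a) = a / (a + b + 1) := by
    unfold heightDiff
    rw [Real.rpow_neg (by norm_num), Real.rpow_logb (by norm_num) (by norm_num) (by positivity)]
    push_cast
    rw [inv_div]
  rw [e]
  unfold heightDiff
  push_cast
  constructor
  · rw [Real.logb_le_iff_le_rpow (by norm_num) (by positivity), div_le_iff₀ hb]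
    norm_num
    linarith
  · unfold Real.logb
    rw [div_le_iff₀ (Real.log_pos (by norm_num))]
    have h1 := Real.log_le_sub_one_of_pos (x := ((a : ℝ) + b + 1) / b) (by positivity)
    -- This is `(a + 1) (a + b + 1) ≤ 2a * 3b`; the 9 in the statement exceeds `6 / log 2`.
    have h2 : ((a : ℝ) + b + 1) / b - 1 ≤ 6 * (a / (a + b + 1)) := by
      rw [div_sub_one hb.ne', mul_div_assoc', div_le_div_iff₀ hb (by positivity)]
      nlinarith [mul_le_mul ha' h' (by linarith) (by linarith)]
    have h3 := Real.log_two_gt_d9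
    have h4 : 0 ≤ (a : ℝ) / (a + b + 1) := by positivity
    nlinarith

lemma linkCost_cases {a b : ℕ} (ha : 0 < a) (hb : 0 < b) (H : ℝ) :
    ∃ u v : ℝ, 0 ≤ u ∧ 0 ≤ v ∧ v ≤ 2 ∧ v ≤ 9 * (2 : ℝ) ^ (-u) ∧
      (u = heightDiff (a + b + 1) a ∨ u = heightDiff (a + b + 1) b) ∧
      linkCost (heightDiff (a + b + 1) a) (heightDiff (a + b + 1) b) H = linkCost u v H := by
  have h1 := heightDiff_nonneg (p := a + b + 1) ha (by omega)
  have h2 := heightDiff_nonneg (p := a + b + 1) hb (by omega)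
  rcases le_total a b with h | h
  · obtain ⟨h3, h4⟩ := heightDiff_larger ha h
    exact ⟨_, _, h1, h2, h3, h4, Or.inl rfl, rfl⟩
  · obtain ⟨h3, h4⟩ := heightDiff_larger hb h
    rw [show b + a + 1 = a + b + 1 by ring] at h3 h4
    exact ⟨_, _, h2, h1, h3, h4, Or.inr rfl, linkCost_comm _ _ _⟩

lemma linkDelta_le_two_add {a b : ℕ} (c : ℕ) (ha : 0 < a) (hb : 0 < b) :
    linkDelta a b c ≤ 2 + phi (heightDiff (a + b + c + 2) (b + c + 1)) := by
  refine (linkDelta_le_linkCost c ha hb).trans ?_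
  obtain ⟨u, v, hu, hv, hv2, -, -, he⟩ :=
    linkCost_cases ha hb (heightDiff (a + b + c + 2) (a + b + 1))
  rw [he]
  have := linkCost_le_of_le hu hv (heightDiff_nonneg (p := a + b + c + 2) (s := a + b + 1)
    (by omega) (by omega))
  linarith

lemma heightDiff_rest_nonneg (a b c : ℕ) : 0 ≤ heightDiff (a + b + c + 2) (b + c + 1) :=
  heightDiff_nonneg (by omega) (by omega)

lemma exists_linkDelta_le : ∃ C : ℝ, 1 ≤ C ∧ ∀ a b c : ℕ, 0 < a → 0 < b →
    linkDelta a b c ≤ C * (level (a + b + c + 2) - level c) := by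
  obtain ⟨c₁, hc₁, hneg⟩ := exists_linkCost_nonpos
  -- For `H ≥ c₁` only `phi z` is left, paid with coefficient 1. For `H ≤ c₁` the level drops by at
  -- least `2 ^ (-c₁)`, and `2 * 2 ^ c₁` times the drop pays the extra cost 2.
  refine ⟨1 + 2 * 2 ^ c₁, by linarith [Real.rpow_pos_of_pos (zero_lt_two (α := ℝ)) c₁],
    fun a b c ha hb => ?_⟩
  have hz := heightDiff_le_level_sub a b c
  have hz0 := heightDiff_rest_nonneg a b c
  have hzphi := phi_le_self hz0
  have h2 : (0 : ℝ) < 2 ^ c₁ := by positivity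
  rcases le_total c₁ (heightDiff (a + b + c + 2) (a + b + 1)) with h | h
  · have hl := linkDelta_le_linkCost c ha hb
    obtain ⟨u, v, hu, hv, -, hv9, -, he⟩ :=
      linkCost_cases ha hb (heightDiff (a + b + c + 2) (a + b + 1))
    rw [he] at hl
    have := hneg u v _ hu hv hv9 h
    nlinarith
  · have hl := linkDelta_le_two_add c ha hb
    have h3 := rpow_neg_le_level_sub (c := c) (by omega) (by omega) h
    rw [Real.rpow_neg (by norm_num), inv_le_iff_one_le_mul₀ h2] at h3
    nlinarith

/-- A rotation of subtrees with bounded height differences either gains `K` or leads to a much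
smaller height difference. -/
lemma exists_linkDelta_gain {K : ℝ} (hK : 0 ≤ K) : ∃ C : ℝ, ∀ (a b c : ℕ) (t : ℝ), 0 < a → 0 < b →
    0 ≤ t → heightDiff (a + b + c + 2) a ≤ t → heightDiff (b + c + 1) b ≤ t →
    linkDelta a b c ≤ C * (level (a + b + c + 2) - level c) - K ∨
      heightDiff (a + b + c + 2) (a + b + 1) ≤ 10 * (K + 2) * Real.logb 2 (4 + t) ^ 2 := by
  obtain ⟨C, hC, hlink⟩ := exists_linkDelta_le
  refine ⟨C + K, fun a b c t ha hb ht hat hbt => ?_⟩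
  rw [or_iff_not_imp_right]
  intro hH
  rw [not_le] at hH
  have hz := heightDiff_le_level_sub a b c
  have hz0 := heightDiff_rest_nonneg a b c
  have hzphi := phi_le_self hz0
  -- If `z ≥ 1`, the level drops by at least 1, and the summand `K` of the constant pays for the
  -- missing gain. Otherwise the height of `b` measured from the top exceeds its old one by at most
  -- 1.
  rcases le_total 1 (heightDiff (a + b + c + 2) (b + c + 1)) with h | h
  · have := hlink a b c ha hb
    nlinarith
  have h3 := heightDiff_add (p := a + b + c + 2) (r := a + b + 1) (s := a)
    (by omega) (by omega) (by omega)
  have h4 := heightDiff_add (p := a + b + c + 2) (r := a + b + 1) (s := b)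
    (by omega) (by omega) (by omega)
  have h5 := heightDiff_add (p := a + b + c + 2) (r := b + c + 1) (s := b)
    (by omega) (by omega) (by omega)
  have hl := linkDelta_le_linkCost c ha hb
  have hH0 := heightDiff_nonneg (p := a + b + c + 2) (s := a + b + 1) (by omega) (by omega)
  obtain ⟨u, v, hu, hv, hv2, -, hux, he⟩ :=
    linkCost_cases ha hb (heightDiff (a + b + c + 2) (a + b + 1))
  rw [he] at hl
  set H := heightDiff (a + b + c + 2) (a + b + 1)
  have hut : u + H ≤ 1 + t := by rcases hux with rfl | rfl <;> linarith
  have hlog : Real.logb 2 (2 + (u + H)) ≤ Real.logb 2 (4 + t) :=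
    logb_two_mono (by linarith) (by linarith)
  have hlog1 : 1 ≤ Real.logb 2 (2 + (u + H)) := one_le_logb_two_add (by linarith)
  have hcost := linkCost_le hu hv hH0
  -- The extra 2 offsets `v ≤ 2`.
  have hgain : K + 2 ≤ H / (10 * Real.logb 2 (2 + (u + H)) ^ 2) := by
    rw [le_div_iff₀ (by positivity)]
    have : Real.logb 2 (2 + (u + H)) ^ 2 ≤ Real.logb 2 (4 + t) ^ 2 := by gcongr
    nlinarith
  nlinarith

/-! ### Pairing rounds on lists of subtree sizes

A path is described by the list `w` of the sizes of the subtrees that hang off its nodes and the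
size `c` of the subtree below its last node. -/

/-- The number of nodes of the subtree at the first node of a path. -/
def pathSize (c : ℕ) : List ℕ → ℕ
  | [] => c
  | a :: w => a + pathSize c w + 1

/-- The sizes of the hanging subtrees after a pairing round. -/
def pairUp : List ℕ → List ℕ
  | a :: b :: w => (a + b + 1) :: pairUp w
  | w => w

/-- The change of the potential in a pairing round. -/
noncomputable def roundCost (c : ℕ) : List ℕ → ℝ
  | a :: b :: w => linkDelta a b (pathSize c w) + roundCost c w
  | _ => 0

/-- The change of the potential in the last `j` pairing rounds, on a path with `2 ^ j - 2` nodes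
that take part in the rotations. -/
noncomputable def laterCost : ℕ → ℕ → List ℕ → ℝ
  | 0, _, _ => 0
  | j + 1, c, w => roundCost c w
      + laterCost j (pathSize c ((pairUp w).drop (2 ^ j - 2))) ((pairUp w).take (2 ^ j - 2))

/-- The number of hanging subtrees whose height difference exceeds `t`. -/
noncomputable def numHigh (t : ℝ) (c : ℕ) : List ℕ → ℝ
  | [] => 0
  | a :: w => (if t < heightDiff (pathSize c (a :: w)) a then 1 else 0) + numHigh t c w

lemma pathSize_append (c : ℕ) (w v : List ℕ) :
    pathSize c (w ++ v) = pathSize (pathSize c v) w := by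
  induction w with
  | nil => rfl
  | cons a w ih => simp [pathSize, ih]

lemma pathSize_pairUp (c : ℕ) (w : List ℕ) : pathSize c (pairUp w) = pathSize c w := by
  induction w using pairUp.induct with
  | case1 a b w ih => simp only [pairUp, pathSize, ih]; ring
  | case2 w h => rw [pairUp]; exact h

lemma two_mul_length_pairUp (m : ℕ) (w : List ℕ) (h : w.length = 2 * m) :
    (pairUp w).length = m := by
  induction m generalizing w with
  | zero => obtain rfl : w = [] := by simpa using h
            rfl
  | succ m ih =>
    match w, h with
    | a :: b :: w, h => simp [pairUp, ih w (by simp at h; omega)]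
    | [_], h => simp at h; omega
    | [], h => simp at h

lemma pairUp_pos (w : List ℕ) (h : ∀ a ∈ w, 0 < a) : ∀ a ∈ pairUp w, 0 < a := by
  induction w using pairUp.induct with
  | case1 a b w ih =>
    simp only [pairUp, List.mem_cons, forall_eq_or_imp] at h ⊢
    exact ⟨by omega, ih h.2.2⟩
  | case2 w hw => rw [pairUp]; exacts [h, hw]

lemma numHigh_nonneg (t : ℝ) (c : ℕ) (w : List ℕ) : 0 ≤ numHigh t c w := by
  induction w with
  | nil => exact le_rfl
  | cons a w ih => simp only [numHigh]; split_ifs <;> linarith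

lemma numHigh_append (t : ℝ) (c : ℕ) (w v : List ℕ) :
    numHigh t c (w ++ v) = numHigh t (pathSize c v) w + numHigh t c v := by
  induction w with
  | nil => simp [numHigh]
  | cons a w ih =>
    change (if t < heightDiff (pathSize c (a :: w ++ v)) a then (1 : ℝ) else 0)
      + numHigh t c (w ++ v) = _
    rw [ih, pathSize_append, ← add_assoc]
    rfl

lemma numHigh_take_le (t : ℝ) (c i : ℕ) (w : List ℕ) :
    numHigh t (pathSize c (w.drop i)) (w.take i) ≤ numHigh t c w := by
  conv_rhs => rw [← List.take_append_drop i w, numHigh_append]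
  linarith [numHigh_nonneg t c (w.drop i)]

lemma pathSize_take (c i : ℕ) (w : List ℕ) :
    pathSize (pathSize c (w.drop i)) (w.take i) = pathSize c w := by
  rw [← pathSize_append, List.take_append_drop]

lemma pathSize_cons_cons (c a b : ℕ) (w : List ℕ) :
    pathSize c (a :: b :: w) = a + b + pathSize c w + 2 := by
  simp only [pathSize]; ring

lemma numHigh_eq_zero (t : ℝ) (c : ℕ) (w : List ℕ) (hw : ∀ a ∈ w, 0 < a)
    (ht : level (pathSize c w) ≤ t) : numHigh t c w = 0 := by
  induction w with
  | nil => rfl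
  | cons a w ih =>
    simp only [List.mem_cons, forall_eq_or_imp] at hw
    have h1 : heightDiff (pathSize c (a :: w)) a ≤ level (pathSize c (a :: w)) := by
      have ha : (1 : ℝ) ≤ a := by exact_mod_cast hw.1
      have hs : (0 : ℝ) < (pathSize c (a :: w) : ℕ) := by
        simp only [pathSize]; positivity
      refine logb_two_mono (by positivity) ?_
      rw [div_le_iff₀ (by linarith)]
      nlinarith
    have h2 : level (pathSize c w) ≤ level (pathSize c (a :: w)) :=
      level_mono (by simp only [pathSize]; omega)
    simp only [numHigh]
    rw [if_neg (by linarith), ih hw.2 (by linarith), add_zero]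

/-- All but logarithmically many hanging subtrees have a large height difference. -/
lemma length_le_numHigh_add (t : ℝ) (c : ℕ) (w : List ℕ) (hw : ∀ a ∈ w, 0 < a) :
    (w.length : ℝ) ≤ numHigh t c w + 2 ^ t * level (pathSize c w) := by
  induction w with
  | nil => simpa [numHigh, pathSize] using mul_nonneg (by positivity) (level_nonneg c)
  | cons a w ih =>
    simp only [List.mem_cons, forall_eq_or_imp] at hw
    have h1 := ih hw.2
    have hp : (0 : ℝ) < 2 ^ t := by positivity
    have h2 : level (pathSize c w) ≤ level (pathSize c (a :: w)) :=
      level_mono (by simp only [pathSize]; omega)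
    simp only [numHigh, List.length_cons]
    push_cast
    split_ifs with h
    · nlinarith
    · have h3 := rpow_neg_le_level_sub (c := pathSize c w) hw.1
        (s := pathSize c (a :: w)) (by simp only [pathSize]; omega) (not_lt.1 h)
      rw [Real.rpow_neg (by norm_num), inv_le_iff_one_le_mul₀ hp] at h3
      linarith

/-! ### Bounds for the cost of one pairing round -/

lemma roundCost_eq_zero {c : ℕ} {w : List ℕ} (h : ∀ a b v, w = a :: b :: v → False) :
    roundCost c w = 0 := by
  rw [roundCost]; exact h

lemma roundCost_le {C : ℝ} (hC : ∀ a b c : ℕ, 0 < a → 0 < b →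
      linkDelta a b c ≤ C * (level (a + b + c + 2) - level c)) (hC0 : 0 ≤ C)
    (c : ℕ) (w : List ℕ) (hw : ∀ a ∈ w, 0 < a) :
    roundCost c w ≤ C * level (pathSize c w) := by
  induction w using pairUp.induct with
  | case1 a b w ih =>
    simp only [List.mem_cons, forall_eq_or_imp] at hw
    have h1 := ih hw.2.2
    have h2 := hC a b (pathSize c w) hw.1 hw.2.1
    rw [pathSize_cons_cons, roundCost]
    linarith
  | case2 w h =>
    rw [roundCost_eq_zero h]
    exact mul_nonneg hC0 (level_nonneg _)

/-- The first round may end with a node without a hanging subtree. -/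
lemma roundCost_le_of_dropLast {C : ℝ} (hC : ∀ a b c : ℕ, 0 < a → 0 < b →
      linkDelta a b c ≤ C * (level (a + b + c + 2) - level c)) (hC1 : 1 ≤ C)
    (c : ℕ) (w : List ℕ) (hw : ∀ a ∈ w.dropLast, 0 < a) :
    roundCost c w ≤ C * level (pathSize c w) + level (pathSize c w) := by
  have hC0 : 0 ≤ C := by linarith
  induction w using pairUp.induct with
  | case1 a b w ih =>
    rw [pathSize_cons_cons, roundCost]
    have hlev : level (pathSize c w) ≤ level (a + b + pathSize c w + 2) :=
      level_mono (by omega)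
    rcases w with _ | ⟨d, w⟩
    · simp only [roundCost, add_zero]
      simp only [List.dropLast_cons_cons, List.dropLast_singleton, List.mem_singleton,
        forall_eq] at hw
      rcases Nat.eq_zero_or_pos b with rfl | hb
      · have := linkDelta_zero_right_le a (pathSize c [])
        have h0 := mul_nonneg hC0 (level_nonneg (a + 0 + pathSize c [] + 2))
        simp only [add_zero] at *
        linarith
      · have := hC a b (pathSize c []) hw hb
        have := mul_nonneg hC0 (level_nonneg (pathSize c []))
        linarith [level_nonneg (a + b + pathSize c [] + 2)]
    · simp only [List.dropLast_cons_cons, List.mem_cons, forall_eq_or_imp] at hw ih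
      have h1 := ih hw.2.2
      have h2 := hC a b (pathSize c (d :: w)) hw.1 hw.2.1
      linarith
  | case2 w h =>
    rw [roundCost_eq_zero h]
    exact add_nonneg (mul_nonneg hC0 (level_nonneg _)) (level_nonneg _)

/-- Meant for paths shorter than `log n`: the values `z` of the `m` rotations add up to at most the
level, and `phi_le_chord` with a common `τ` bounds the sum of the `phi z`. Each rotation costs 2
besides. -/
lemma roundCost_le_length (τ : ℝ) (hτ : 0 ≤ τ) (c m : ℕ) (w : List ℕ) (hw : ∀ a ∈ w, 0 < a)
    (hm : w.length = 2 * m) :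
    roundCost c w ≤ 2 * m + (τ * m + level (pathSize c w)) / Real.logb 2 (2 + τ) ^ 2 := by
  induction m generalizing w with
  | zero =>
    obtain rfl : w = [] := by simpa using hm
    simp only [roundCost]
    have := level_nonneg (pathSize c [])
    push_cast
    rw [mul_zero, mul_zero, zero_add, zero_add]
    positivity
  | succ m ih =>
    match w, hm with
    | [_], h => simp at h; omega
    | [], h => simp at h
    | a :: b :: w, h =>
      simp only [List.mem_cons, forall_eq_or_imp] at hw
      have h1 := ih w hw.2.2 (by simp at h; omega)
      have h2 := linkDelta_le_two_add (pathSize c w) hw.1 hw.2.1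
      have h3 := phi_le_chord (heightDiff_rest_nonneg a b (pathSize c w)) hτ
      have h4 := heightDiff_le_level_sub a b (pathSize c w)
      have h5 : (τ + heightDiff (a + b + pathSize c w + 2) (b + pathSize c w + 1))
            / Real.logb 2 (2 + τ) ^ 2
          ≤ (τ + (level (a + b + pathSize c w + 2) - level (pathSize c w)))
            / Real.logb 2 (2 + τ) ^ 2 := by gcongr
      rw [pathSize_cons_cons, roundCost]
      have h6 : (τ + (level (a + b + pathSize c w + 2) - level (pathSize c w)))
            / Real.logb 2 (2 + τ) ^ 2 + (τ * m + level (pathSize c w)) / Real.logb 2 (2 + τ) ^ 2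
          = (τ * (m + 1 : ℕ) + level (a + b + pathSize c w + 2)) / Real.logb 2 (2 + τ) ^ 2 := by
        push_cast; ring
      push_cast at h6 ⊢
      linarith

/-- Amortization with `K` credits on every high subtree. A new subtree that is high for `t'` takes
its credit from a high old one, or from the gain of the rotation when both old ones are low for `t`.
-/
lemma roundCost_le_numHigh {C K t t' : ℝ} (hK : 0 ≤ K)
    (hC : ∀ a b c : ℕ, 0 < a → 0 < b → linkDelta a b c ≤ C * (level (a + b + c + 2) - level c))
    (hC' : ∀ a b c : ℕ, 0 < a → 0 < b →
      heightDiff (a + b + c + 2) a ≤ t → heightDiff (b + c + 1) b ≤ t →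
      linkDelta a b c ≤ C * (level (a + b + c + 2) - level c) - K ∨
        heightDiff (a + b + c + 2) (a + b + 1) ≤ t')
    (hC0 : 0 ≤ C) (c m : ℕ) (w : List ℕ) (hw : ∀ a ∈ w, 0 < a) (hm : w.length = 2 * m) :
    roundCost c w ≤ C * level (pathSize c w) + K * numHigh t c w - K * numHigh t' c (pairUp w) := by
  induction m generalizing w with
  | zero =>
    obtain rfl : w = [] := by simpa using hm
    simp only [roundCost, pairUp, numHigh, mul_zero, add_zero, sub_zero]
    exact mul_nonneg hC0 (level_nonneg _)
  | succ m ih =>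
    match w, hm with
    | [_], h => simp at h; omega
    | [], h => simp at h
    | a :: b :: w, h =>
      simp only [List.mem_cons, forall_eq_or_imp] at hw
      have h1 := ih w hw.2.2 (by simp at h; omega)
      have h2 := hC a b (pathSize c w) hw.1 hw.2.1
      have h3 := hC' a b (pathSize c w) hw.1 hw.2.1
      have e1 : pathSize c ((a + b + 1) :: pairUp w) = a + b + pathSize c w + 2 := by
        simp only [pathSize, pathSize_pairUp]; ring
      have e2 : pathSize c (b :: w) = b + pathSize c w + 1 := rfl
      simp only [pairUp, numHigh, roundCost]
      rw [e1, e2, pathSize_cons_cons]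
      -- The one case that needs `hC'` has a high new subtree made from two low ones.
      split_ifs with g1 g2 g3 g4 g5 g6 g7 <;> try nlinarith
      rcases h3 (not_lt.1 ‹_›) (not_lt.1 ‹_›) with h4 | h4 <;> linarith

/-! ### The iterated logarithm -/

lemma exists_iterate_logb_le_one (m : ℕ) (x : ℝ) (hx : x ≤ m + 1) (hx0 : 1 < x) :
    ∃ i, (Real.logb 2)^[i] x ≤ 1 := by
  induction m generalizing x with
  | zero => exact ⟨0, by simpa using hx⟩
  | succ m ih =>
    rcases le_or_gt x 2 with h | h
    · refine ⟨1, ?_⟩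
      rw [Function.iterate_one, Real.logb_le_iff_le_rpow (by norm_num) (by linarith)]
      simpa using h
    · have h1 : Real.logb 2 x ≤ x - 1 := by
        rw [Real.logb_le_iff_le_rpow (by norm_num) (by linarith)]
        have := one_add_mul_self_le_rpow_one_add (s := 1) (by norm_num) (p := x - 1) (by linarith)
        norm_num at this
        linarith
      have h2 : 1 < Real.logb 2 x := by
        rw [Real.lt_logb_iff_rpow_lt (by norm_num) (by linarith)]
        simpa using h
      push_cast at hx
      obtain ⟨i, hi⟩ := ih (Real.logb 2 x) (by linarith) h2
      exact ⟨i + 1, by simpa using hi⟩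

lemma iterate_logStar_le_one {x : ℝ} (hx : 1 < x) : (Real.logb 2)^[logStar x] x ≤ 1 := by
  obtain ⟨m, hm⟩ := exists_nat_ge x
  exact Nat.sInf_mem (exists_iterate_logb_le_one m x (by linarith) hx)

lemma one_lt_iterate_of_lt_logStar {x : ℝ} {i : ℕ} (hi : i < logStar x) :
    1 < (Real.logb 2)^[i] x :=
  not_le.1 (Nat.notMem_of_lt_sInf (s := {i : ℕ | (Real.logb 2)^[i] x ≤ 1}) hi)

lemma one_le_logStar {x : ℝ} (hx : 1 < x) : 1 ≤ logStar x := by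
  by_contra! h
  have := iterate_logStar_le_one hx
  rw [Nat.lt_one_iff.1 h] at this
  simp at this
  linarith

/-- The thresholds `16384 (2 + y)²` absorb one step of the recursion: the argument on the left is at
most `2 ^ 18 * y²`, and `40 * 81 ≤ 16384`. -/
lemma forty_mul_logb_sq_le {y : ℝ} (hy : 1 < y) :
    40 * Real.logb 2 (4 + 16384 * (2 + y) ^ 2) ^ 2 ≤ 16384 * (2 + Real.logb 2 y) ^ 2 := by
  have hy0 : 0 < y := by linarith
  have hl : 0 < Real.logb 2 y := Real.logb_pos (by norm_num) hy
  have h1 : Real.logb 2 (4 + 16384 * (2 + y) ^ 2) ≤ 18 + 2 * Real.logb 2 y := by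
    rw [Real.logb_le_iff_le_rpow (by norm_num) (by positivity), Real.rpow_add (by norm_num),
      mul_comm (2 : ℝ) (Real.logb 2 y), Real.rpow_mul (by norm_num),
      Real.rpow_logb (by norm_num) (by norm_num) hy0]
    rw [show (18 : ℝ) = ((18 : ℕ) : ℝ) by norm_num, Real.rpow_natCast,
      show (2 : ℝ) = ((2 : ℕ) : ℝ) by norm_num, Real.rpow_natCast]
    push_cast
    nlinarith
  have h2 : 0 ≤ Real.logb 2 (4 + 16384 * (2 + y) ^ 2) :=
    Real.logb_nonneg (by norm_num) (by nlinarith [sq_nonneg (2 + y)])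
  have h3 : Real.logb 2 (4 + 16384 * (2 + y) ^ 2) ≤ 9 * (2 + Real.logb 2 y) := by linarith
  calc 40 * Real.logb 2 (4 + 16384 * (2 + y) ^ 2) ^ 2 ≤ 40 * (9 * (2 + Real.logb 2 y)) ^ 2 := by
        gcongr
    _ ≤ _ := by nlinarith [sq_nonneg (2 + Real.logb 2 y)]

/-- Thresholds for the height differences that fall from `log₂ n` to a constant within
`log* n` steps. -/
lemma exists_thresholds : ∃ T : ℝ, ∀ n : ℕ, 2 ≤ n → ∃ t : ℕ → ℝ, (∀ i, 0 ≤ t i) ∧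
    level (2 * n + 1) ≤ t 0 ∧ t (logStar n) ≤ T ∧
    ∀ i < logStar n, 40 * Real.logb 2 (4 + t i) ^ 2 ≤ t (i + 1) := by
  refine ⟨16384 * 9, fun n hn =>
    ⟨fun i => 16384 * (2 + (Real.logb 2)^[i] n) ^ 2, fun i => by positivity, ?_, ?_, ?_⟩⟩
  · have hn' : (2 : ℝ) ≤ n := by exact_mod_cast hn
    have h1 : level (2 * n + 1) ≤ 2 * (2 * n + 2) := by
      unfold level Real.logb
      rw [div_le_iff₀ (Real.log_pos (by norm_num))]
      have := Real.log_le_sub_one_of_pos (x := ((2 * n + 1 : ℕ) : ℝ) + 1) (by positivity)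
      push_cast at this ⊢
      have := Real.log_two_gt_d9
      nlinarith
    simp only [Function.iterate_zero, id]
    nlinarith
  · have hn' : (1 : ℝ) < n := by exact_mod_cast hn
    have h1 := one_le_logStar hn'
    obtain ⟨r, hr⟩ : ∃ r, logStar (n : ℝ) = r + 1 := ⟨_, (Nat.succ_pred_eq_of_pos h1).symm⟩
    have h2 := iterate_logStar_le_one hn'
    have h3 := one_lt_iterate_of_lt_logStar (x := n) (i := r) (by omega)
    -- The last iterate lies in `(0, 1]`. Positivity is needed because the threshold squares it, and
    -- gives the value `16384 * 3²`.
    have h4 := Real.logb_pos (b := 2) (by norm_num) h3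
    rw [hr] at h2 ⊢
    rw [← Function.iterate_succ_apply' (Real.logb 2) r] at h4
    nlinarith
  · intro i hi
    have h1 := one_lt_iterate_of_lt_logStar hi
    simp only [Function.iterate_succ_apply']
    exact forty_mul_logb_sq_le h1

/-! ### The later rounds -/

/-- The sizes of the hanging subtrees of the nodes that take part in the last `j` rounds. -/
structure IsRoundList (j : ℕ) (w : List ℕ) : Prop where
  length_eq : w.length = 2 ^ j - 2
  pos : ∀ a ∈ w, 0 < a

lemma IsRoundList.length_eq_two_mul {j : ℕ} {w : List ℕ} (h : IsRoundList (j + 1) w) :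
    w.length = 2 * (2 ^ j - 1) := by
  rw [h.length_eq, pow_succ]; omega

lemma IsRoundList.next {j : ℕ} {w : List ℕ} (h : IsRoundList (j + 1) w) :
    IsRoundList j ((pairUp w).take (2 ^ j - 2)) where
  length_eq := by
    rw [List.length_take, two_mul_length_pairUp _ w h.length_eq_two_mul]; omega
  pos a ha := pairUp_pos w h.pos a (List.mem_of_mem_take ha)

lemma pathSize_next (c i : ℕ) (w : List ℕ) :
    pathSize (pathSize c ((pairUp w).drop i)) ((pairUp w).take i) = pathSize c w := by
  rw [pathSize_take, pathSize_pairUp]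

/-- Here `i` counts the rounds since the path became shorter than `Λ`. With `τ = 2 ^ i` the next
round costs at most `2 * 2 ^ j + 8Λ / (1 + i)²`; the first terms form a geometric series, and the
second ones are dominated by differences of `16Λ / (1 + i)`. -/
lemma laterCost_le_of_two_pow_le (j i c : ℕ) (w : List ℕ) (hw : IsRoundList j w) (Λ : ℝ)
    (hΛ : level (pathSize c w) ≤ Λ) (h : (2 : ℝ) ^ (j + i) ≤ Λ) :
    laterCost j c w ≤ 2 * 2 ^ j + 16 * Λ / (1 + i) := by
  have hΛ0 : 0 ≤ Λ := le_trans (by positivity) h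
  induction j generalizing i c w with
  | zero => simp only [laterCost]; positivity
  | succ j ih =>
    have h1 := ih (i + 1) _ _ hw.next (by rw [pathSize_next]; exact hΛ)
      (by rwa [show j + (i + 1) = j + 1 + i by ring])
    have h2 := roundCost_le_length (2 ^ i) (by positivity) c _ w hw.pos hw.length_eq_two_mul
    have hm : (((2 ^ j - 1 : ℕ)) : ℝ) ≤ 2 ^ j := by
      exact_mod_cast Nat.sub_le (2 ^ j) 1
    have h3 : (2 : ℝ) ^ i * ((2 ^ j - 1 : ℕ) : ℝ) + level (pathSize c w) ≤ 2 * Λ := by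
      have : (2 : ℝ) ^ i * ((2 ^ j - 1 : ℕ) : ℝ) ≤ 2 ^ i * 2 ^ j := by gcongr
      have e : (2 : ℝ) ^ (j + 1 + i) = 2 * (2 ^ i * 2 ^ j) := by ring
      have : (0 : ℝ) < 2 ^ i * 2 ^ j := by positivity
      linarith
    have h4 : ((1 : ℝ) + i) / 2 ≤ Real.logb 2 (2 + 2 ^ i) := by
      have g1 : 1 ≤ Real.logb 2 (2 + 2 ^ i) := one_le_logb_two_add (by positivity)
      have g2 : (i : ℝ) ≤ Real.logb 2 (2 + 2 ^ i) := by
        rw [Real.le_logb_iff_rpow_le (by norm_num) (by positivity), Real.rpow_natCast]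
        linarith
      linarith
    have h5 : ((2 : ℝ) ^ i * ((2 ^ j - 1 : ℕ) : ℝ) + level (pathSize c w))
        / Real.logb 2 (2 + 2 ^ i) ^ 2 ≤ 2 * Λ / (((1 : ℝ) + i) / 2) ^ 2 := by
      gcongr
    have h6 : 2 * Λ / (((1 : ℝ) + i) / 2) ^ 2 + 16 * Λ / (1 + (i + 1 : ℕ)) ≤ 16 * Λ / (1 + i) := by
      have e : 16 * Λ / (1 + i) - (2 * Λ / (((1 : ℝ) + i) / 2) ^ 2 + 16 * Λ / (1 + (i + 1 : ℕ)))
          = 8 * Λ * i / ((1 + i) ^ 2 * (2 + i)) := by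
        push_cast
        have : (1 : ℝ) + i ≠ 0 := by positivity
        have : (2 : ℝ) + i ≠ 0 := by positivity
        have : (1 : ℝ) + (i + 1) ≠ 0 := by positivity
        field_simp
        ring
      have : 0 ≤ 8 * Λ * i / ((1 + i) ^ 2 * (2 + i)) := by positivity
      linarith
    rw [laterCost, pow_succ]
    linarith

section

variable {C Λ : ℝ} (hC : ∀ a b c : ℕ, 0 < a → 0 < b →
  linkDelta a b c ≤ C * (level (a + b + c + 2) - level c)) (hC0 : 0 ≤ C)

include hC hC0

lemma laterCost_succ_le {j c : ℕ} {w : List ℕ} (hw : IsRoundList (j + 1) w)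
    (hΛ : level (pathSize c w) ≤ Λ) :
    laterCost (j + 1) c w ≤ C * Λ + laterCost j (pathSize c ((pairUp w).drop (2 ^ j - 2)))
      ((pairUp w).take (2 ^ j - 2)) := by
  have h1 := roundCost_le hC hC0 c w hw.pos
  have h2 := mul_le_mul_of_nonneg_left hΛ hC0
  rw [laterCost]
  linarith

/-- At most `u` rounds of cost `CΛ` bring `2 ^ j` down to `Λ`; the rest costs `2Λ + 16Λ`. -/
lemma laterCost_le_of_two_pow_le_mul (u j c : ℕ) (w : List ℕ) (hw : IsRoundList j w)
    (hΛ : level (pathSize c w) ≤ Λ) (h : (2 : ℝ) ^ j ≤ 2 ^ u * Λ) :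
    laterCost j c w ≤ (18 + C * u) * Λ := by
  have hΛ0 : 0 ≤ Λ := (level_nonneg _).trans hΛ
  induction u generalizing j c w with
  | zero =>
    have h1 := laterCost_le_of_two_pow_le j 0 c w hw Λ hΛ (by simpa using h)
    norm_num at h h1 ⊢
    linarith
  | succ u ih =>
    rcases j with _ | j
    · simp only [laterCost]; positivity
    · have h1 := laterCost_succ_le hC hC0 hw hΛ
      have h2 := ih j _ _ hw.next (by rw [pathSize_next]; exact hΛ)
        (by rw [pow_succ, pow_succ] at h; linarith)
      push_cast
      linarith

/-- The credits telescope over `r` rounds as the threshold moves from `t i` to `t (i + 1)`. Subtrees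
leaving the active list only release credits. -/
lemma laterCost_window {K : ℝ} (hK : 0 ≤ K) (r : ℕ) (t : ℕ → ℝ)
    (hC' : ∀ i < r, ∀ a b c : ℕ, 0 < a → 0 < b →
      heightDiff (a + b + c + 2) a ≤ t i → heightDiff (b + c + 1) b ≤ t i →
      linkDelta a b c ≤ C * (level (a + b + c + 2) - level c) - K ∨
        heightDiff (a + b + c + 2) (a + b + 1) ≤ t (i + 1))
    (j c : ℕ) (w : List ℕ) (hw : IsRoundList (j + r) w) (hΛ : level (pathSize c w) ≤ Λ) :
    ∃ c' w', IsRoundList j w' ∧ pathSize c' w' = pathSize c w ∧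
      laterCost (j + r) c w ≤ C * r * Λ + K * numHigh (t 0) c w - K * numHigh (t r) c' w'
        + laterCost j c' w' := by
  induction r generalizing t c w with
  | zero => exact ⟨c, w, hw, rfl, by simp⟩
  | succ r ih =>
    rw [← add_assoc] at hw
    obtain ⟨c', w', h1, h2, h3⟩ := ih (fun i => t (i + 1))
      (fun i hi => hC' (i + 1) (by omega)) (pathSize c ((pairUp w).drop (2 ^ (j + r) - 2)))
      ((pairUp w).take (2 ^ (j + r) - 2)) hw.next (by rw [pathSize_next]; exact hΛ)
    refine ⟨c', w', h1, by rw [h2, pathSize_next], ?_⟩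
    have h4 := roundCost_le_numHigh hK hC (hC' 0 (by omega)) hC0 c _ w hw.pos
      hw.length_eq_two_mul
    have h5 := mul_le_mul_of_nonneg_left
      (numHigh_take_le (t 1) c (2 ^ (j + r) - 2) (pairUp w)) hK
    have h6 := mul_le_mul_of_nonneg_left hΛ hC0
    rw [← add_assoc, laterCost]
    simp only [zero_add] at h3 h4
    push_cast
    linarith

end

/-- If a window of `r` rounds gains as much as it does by the main estimate, then all rounds
together lose only little. -/
lemma laterCost_le_of_window {C D Λ : ℝ} {r e : ℕ} (hr : 1 ≤ r) (hΛ1 : 1 ≤ Λ)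
    (hC : ∀ a b c : ℕ, 0 < a → 0 < b →
      linkDelta a b c ≤ C * (level (a + b + c + 2) - level c)) (hC0 : 0 ≤ C)
    (he : D ≤ 2 * 2 ^ e)
    (hwin : ∀ (j c : ℕ) (w : List ℕ), IsRoundList (j + r) w → level (pathSize c w) ≤ Λ →
      ∃ c' w', IsRoundList j w' ∧ pathSize c' w' = pathSize c w ∧
        laterCost (j + r) c w ≤ D * r * Λ - 2 * 2 ^ j + laterCost j c' w')
    (j c : ℕ) (w : List ℕ) (hw : IsRoundList j w) (hΛ : level (pathSize c w) ≤ Λ) :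
    laterCost j c w ≤ (18 + C * (2 * r + e : ℕ)) * Λ := by
  induction j using Nat.strong_induction_on generalizing c w with
  | _ j ih =>
    rcases le_or_gt ((2 : ℝ) ^ j) (2 ^ (2 * r + e) * Λ) with h | h
    · exact laterCost_le_of_two_pow_le_mul hC hC0 _ j c w hw hΛ h
    have h1 : (2 : ℝ) ^ (2 * r + e) < 2 ^ j := by
      refine lt_of_le_of_lt ?_ h
      exact le_mul_of_one_le_right (by positivity) hΛ1
    have h2 : 2 * r + e < j := (pow_lt_pow_iff_right₀ (by norm_num)).1 h1
    obtain ⟨i, rfl⟩ : ∃ i, j = i + r := ⟨j - r, by omega⟩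
    obtain ⟨c', w', h3, h4, h5⟩ := hwin i c w hw hΛ
    have h6 := ih i (by omega) c' w' h3 (by rw [h4]; exact hΛ)
    -- Since `2 ^ (i + r)` exceeds `2 ^ (2 * r + e) * Λ`, the gain of the window covers its loss:
    -- one factor `2 ^ r` is used up by the shrinking of the path, the other dominates `r`.
    have h7 : D * r * Λ ≤ 2 * 2 ^ i := by
      have g1 : (2 : ℝ) ^ (r + e) * Λ < 2 ^ i := by
        have e1 : (2 : ℝ) ^ (2 * r + e) = 2 ^ r * 2 ^ (r + e) := by ring
        have e2 : (2 : ℝ) ^ (i + r) = 2 ^ r * 2 ^ i := by ring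
        rw [e1, e2, mul_assoc] at h
        exact lt_of_mul_lt_mul_left h (by positivity)
      have g2 : (r : ℝ) ≤ 2 ^ r := by exact_mod_cast Nat.lt_two_pow_self.le
      calc D * r * Λ ≤ 2 * 2 ^ e * 2 ^ r * Λ := by gcongr
        _ = 2 * (2 ^ (r + e) * Λ) := by ring
        _ ≤ _ := by linarith
    linarith

lemma one_le_level {n : ℕ} (hn : 1 ≤ n) : 1 ≤ level n := by
  have : (1 : ℝ) ≤ n := by exact_mod_cast hn
  unfold level
  rw [Real.le_logb_iff_rpow_le (by norm_num) (by linarith)]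
  norm_num
  linarith

/-- The main estimate for the later rounds. -/
theorem exists_laterCost_le : ∃ C : ℝ, 0 ≤ C ∧ ∀ n j c w, 2 ≤ n → IsRoundList j w →
    pathSize c w ≤ 2 * n + 1 →
    laterCost j c w ≤ -(2 * 2 ^ j / 2 ^ logStar n) + C * (level (2 * n + 1) * logStar n) := by
  obtain ⟨C₁, hC₁, hlink⟩ := exists_linkDelta_le
  obtain ⟨C₂, hgain⟩ := exists_linkDelta_gain (K := 2) (by norm_num)
  obtain ⟨T, hT⟩ := exists_thresholds
  set C := max C₁ C₂
  have hC0 : 0 ≤ C := by have := le_max_left C₁ C₂; linarith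
  have hdiff : ∀ a b c : ℕ, 0 ≤ level (a + b + c + 2) - level c := fun a b c =>
    sub_nonneg.2 (level_mono (by omega))
  have hlink' : ∀ a b c : ℕ, 0 < a → 0 < b →
      linkDelta a b c ≤ C * (level (a + b + c + 2) - level c) := fun a b c ha hb =>
    (hlink a b c ha hb).trans (mul_le_mul_of_nonneg_right (le_max_left _ _) (hdiff a b c))
  -- The final credit is at least `2 (2 ^ j - 2 - 2 ^ T * Λ)`; its deficit against `2 * 2 ^ j` gives
  -- `4 + 2 * 2 ^ T`, and `C` comes from the `r` rounds.
  set D := C + 4 + 2 * 2 ^ T with hD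
  have hD0 : 0 ≤ D := by positivity
  obtain ⟨e, he⟩ := pow_unbounded_of_one_lt D (by norm_num : (1 : ℝ) < 2)
  refine ⟨20 + D + C * (2 + e), by positivity, fun n j c w hn hw hsize => ?_⟩
  set r := logStar n
  set Λ := level (2 * n + 1)
  have hr : 1 ≤ r := one_le_logStar (by exact_mod_cast hn)
  have hr' : (1 : ℝ) ≤ r := by exact_mod_cast hr
  have hΛ1 : 1 ≤ Λ := one_le_level (by omega)
  obtain ⟨t, ht0, htn, htr, hts⟩ := hT n hn
  have hwin : ∀ (j c : ℕ) (w : List ℕ), IsRoundList (j + r) w → level (pathSize c w) ≤ Λ →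
      ∃ c' w', IsRoundList j w' ∧ pathSize c' w' = pathSize c w ∧
        laterCost (j + r) c w ≤ D * r * Λ - 2 * 2 ^ j + laterCost j c' w' := by
    intro j c w hw hΛ
    obtain ⟨c', w', h1, h2, h3⟩ := laterCost_window hlink' hC0 (K := 2) (by norm_num) r t
      (fun i hi a b c ha hb h1 h2 => by
        rcases hgain a b c (t i) ha hb (ht0 i) h1 h2 with h | h
        · left
          have := mul_le_mul_of_nonneg_right (le_max_right C₁ C₂) (hdiff a b c)
          linarith
        · right
          have := hts i hi
          norm_num at h
          linarith) j c w hw hΛ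
    refine ⟨c', w', h1, h2, ?_⟩
    have h4 := numHigh_eq_zero (t 0) c w hw.pos (by linarith)
    have h5 := length_le_numHigh_add (t r) c' w' h1.pos
    have h6 : (2 : ℝ) ^ j - 2 ≤ w'.length := by
      rw [h1.length_eq, sub_le_iff_le_add]
      exact_mod_cast (by omega : 2 ^ j ≤ 2 ^ j - 2 + 2)
    have h7 : (2 : ℝ) ^ t r * level (pathSize c' w') ≤ 2 ^ T * Λ := by
      rw [h2]
      exact mul_le_mul (Real.rpow_le_rpow_of_exponent_le (by norm_num) htr) hΛ
        (level_nonneg _) (by positivity)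
    have h8 : (4 + 2 * (2 : ℝ) ^ T) * Λ ≤ (4 + 2 * (2 : ℝ) ^ T) * Λ * r :=
      le_mul_of_one_le_right (by positivity) hr'
    have h9 : D * r * Λ = C * r * Λ + (4 + 2 * (2 : ℝ) ^ T) * Λ * r := by rw [hD]; ring
    rw [h4] at h3
    linarith
  have hup := laterCost_le_of_window hr hΛ1 hlink' hC0 (e := e) (by linarith) hwin
  have hΛ : level (pathSize c w) ≤ Λ := level_mono hsize
  have hΛr : Λ ≤ Λ * r := le_mul_of_one_le_right (by linarith) hr'
  have hfin : (18 + C * (2 * r + e : ℕ)) * Λ ≤ (18 + C * (2 + e)) * (Λ * r) := by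
    push_cast
    have : C * e * Λ ≤ C * e * (Λ * r) := by gcongr
    linarith
  rcases le_or_gt r j with h | h
  · obtain ⟨i, rfl⟩ : ∃ i, j = i + r := ⟨j - r, by omega⟩
    obtain ⟨c', w', h1, h2, h3⟩ := hwin i c w hw hΛ
    have h4 := hup i c' w' h1 (by rw [h2]; exact hΛ)
    have h5 : 2 * (2 : ℝ) ^ (i + r) / 2 ^ r = 2 * 2 ^ i := by
      rw [pow_add]; field_simp
    rw [h5]
    linarith
  -- With fewer than `r` rounds the claimed gain is at most 2 and needs no window.
  · have h4 := hup j c w hw hΛ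
    have h5 : 2 * (2 : ℝ) ^ j / 2 ^ r ≤ 2 := by
      rw [div_le_iff₀ (by positivity)]
      have : (2 : ℝ) ^ j ≤ 2 ^ r := pow_le_pow_right₀ (by norm_num) h.le
      linarith
    have : 0 ≤ D * (Λ * r) := by positivity
    linarith

/-! ### Paths as lists of nodes with hanging subtrees -/

variable {α : Type*}

/-- The node with the subtree `C` in direction `d` and the subtree `A` in the other one. -/
def mkNode (d : Dir) (x : α) (A C : BinaryTree α) : BinaryTree α :=
  match d with
  | .left => .node x C A
  | .right => .node x A C

/-- The tree whose path in direction `d` has the given nodes with the given hanging subtrees, and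
ends in `R`. -/
def spine (d : Dir) : List (α × BinaryTree α) → BinaryTree α → BinaryTree α
  | [], R => R
  | p :: l, R => mkNode d p.1 p.2 (spine d l R)

/-- A pairing round with `m` rotations on a list of nodes with hanging subtrees. -/
def pairPrefix (d : Dir) : ℕ → List (α × BinaryTree α) → List (α × BinaryTree α)
  | m + 1, p :: p' :: l => (p'.1, mkNode d p.1 p.2 p'.2) :: pairPrefix d m l
  | _, l => l

/-- The sizes of the hanging subtrees. -/
def sizes (l : List (α × BinaryTree α)) : List ℕ := l.map fun p => p.2.numNodes

lemma numNodes_mkNode (d : Dir) (x : α) (A C : BinaryTree α) :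
    (mkNode d x A C).numNodes = A.numNodes + C.numNodes + 1 := by
  cases d
  · simp only [mkNode, BinaryTree.numNodes]; ring
  · rfl

lemma numNodes_spine (d : Dir) (l : List (α × BinaryTree α)) (R : BinaryTree α) :
    (spine d l R).numNodes = pathSize R.numNodes (sizes l) := by
  induction l with
  | nil => rfl
  | cons p l ih => simp only [spine, numNodes_mkNode, ih, sizes, List.map_cons, pathSize]

lemma spine_append (d : Dir) (l l' : List (α × BinaryTree α)) (R : BinaryTree α) :
    spine d (l ++ l') R = spine d l (spine d l' R) := by
  induction l with
  | nil => rfl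
  | cons p l ih => simp only [List.cons_append, spine, ih]

lemma potentialBelow_eq (p : ℕ) (t : BinaryTree α) :
    potentialBelow p t = nodePotential p t.numNodes + potential t := by
  cases t with
  | nil => simp [potentialBelow, potential, BinaryTree.numNodes]
  | node a l r => simp only [potentialBelow, potential]; ring

lemma potential_node (a : α) (l r : BinaryTree α) :
    potential (.node a l r) = nodePotential (l.numNodes + r.numNodes + 1) l.numNodes
      + potential l + nodePotential (l.numNodes + r.numNodes + 1) r.numNodes + potential r := by
  rw [potential, potentialBelow_eq, potentialBelow_eq, ← add_assoc]
  rfl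

lemma potential_mkNode (d : Dir) (x : α) (A C : BinaryTree α) :
    potential (mkNode d x A C) = nodePotential (A.numNodes + C.numNodes + 1) A.numNodes
      + potential A + nodePotential (A.numNodes + C.numNodes + 1) C.numNodes + potential C := by
  cases d
  · rw [mkNode, potential_node, add_comm C.numNodes]; ring
  · exact potential_node x A C

lemma rotate_mkNode (d : Dir) (x y : α) (A B C : BinaryTree α) :
    rotate d (mkNode d x A (mkNode d y B C)) = mkNode d y (mkNode d x A B) C := by
  cases d <;> rfl

lemma modifyChild_mkNode (f : BinaryTree α → BinaryTree α) (d : Dir) (x : α)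
    (A C : BinaryTree α) : modifyChild f d (mkNode d x A C) = mkNode d x A (f C) := by
  cases d <;> rfl

lemma pairingRound_spine (d : Dir) (m : ℕ) (l : List (α × BinaryTree α)) (R : BinaryTree α)
    (h : 2 * m ≤ l.length) : pairingRound d m (spine d l R) = spine d (pairPrefix d m l) R := by
  induction m generalizing l with
  | zero => rfl
  | succ m ih =>
    match l, h with
    | p :: p' :: l, h =>
      simp only [pairingRound, spine, rotate_mkNode, modifyChild_mkNode, pairPrefix]
      rw [ih l (by simp at h; omega)]
    | [_], h => simp at h; omega
    | [], h => simp at h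

lemma length_pairPrefix (d : Dir) (m : ℕ) (l : List (α × BinaryTree α))
    (h : 2 * m ≤ l.length) : (pairPrefix d m l).length = l.length - m := by
  induction m generalizing l with
  | zero => rfl
  | succ m ih =>
    match l, h with
    | p :: p' :: l, h =>
      simp only [pairPrefix, List.length_cons] at h ⊢
      rw [ih l (by omega)]; omega
    | [_], h => simp at h; omega
    | [], h => simp at h

lemma pairPrefix_append (d : Dir) (m : ℕ) (l l' : List (α × BinaryTree α))
    (h : l.length = 2 * m) : pairPrefix d m (l ++ l') = pairPrefix d m l ++ l' := by
  induction m generalizing l with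
  | zero => obtain rfl : l = [] := by simpa using h
            rfl
  | succ m ih =>
    match l, h with
    | p :: p' :: l, h =>
      simp only [pairPrefix, List.cons_append]
      rw [ih l (by simp at h; omega)]
    | [_], h => simp at h; omega
    | [], h => simp at h

lemma sizes_pairPrefix (d : Dir) (m : ℕ) (l : List (α × BinaryTree α))
    (h : l.length = 2 * m) : sizes (pairPrefix d m l) = pairUp (sizes l) := by
  induction m generalizing l with
  | zero => obtain rfl : l = [] := by simpa using h
            rfl
  | succ m ih =>
    match l, h with
    | p :: p' :: l, h =>
      have := ih l (by simp at h; omega)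
      simp only [pairPrefix, sizes, List.map_cons, pairUp, numNodes_mkNode] at this ⊢
      rw [this]
    | [_], h => simp at h; omega
    | [], h => simp at h

/-- Rotations preserve the sizes below them, so each one changes only the four potentials compared
in `linkDelta`; the interiors of the hanging subtrees cancel. -/
lemma potential_pairPrefix (d : Dir) (m : ℕ) (l : List (α × BinaryTree α)) (R : BinaryTree α)
    (h : l.length = 2 * m) :
    potential (spine d (pairPrefix d m l) R) - potential (spine d l R)
      = roundCost R.numNodes (sizes l) := by
  induction m generalizing l with
  | zero => obtain rfl : l = [] := by simpa using h
            simp [pairPrefix, sizes, roundCost]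
  | succ m ih =>
    match l, h with
    | p :: p' :: l, h =>
      have hl : l.length = 2 * m := by simp at h; omega
      have h1 := ih l hl
      have h2 : (spine d (pairPrefix d m l) R).numNodes = pathSize R.numNodes (sizes l) := by
        rw [numNodes_spine, sizes_pairPrefix d m l hl, pathSize_pairUp]
      have h3 := numNodes_spine d l R
      simp only [pairPrefix, spine, potential_mkNode, numNodes_mkNode, h2, h3]
      simp only [sizes, List.map_cons, roundCost, linkDelta] at h1 ⊢
      rw [← h1]
      have e : ∀ a b c : ℕ, a + (b + c + 1) + 1 = a + b + c + 2 := fun a b c => by ring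
      have e' : ∀ a b c : ℕ, a + b + 1 + c + 1 = a + b + c + 2 := fun a b c => by ring
      rw [e, e']
      ring
    | [_], h => simp at h; omega
    | [], h => simp at h

/-- The later rounds on a list of nodes with hanging subtrees. -/
def laterPrefix (d : Dir) : ℕ → List (α × BinaryTree α) → List (α × BinaryTree α)
  | 0, l => l
  | j + 1, l => laterPrefix d j (pairPrefix d (2 ^ j - 1) l)

lemma laterRounds_spine (d : Dir) (j : ℕ) (l : List (α × BinaryTree α)) (R : BinaryTree α)
    (h : 2 ^ j - 2 ≤ l.length) :
    laterRounds d j (spine d l R) = spine d (laterPrefix d j l) R := by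
  induction j generalizing l with
  | zero => rfl
  | succ j ih =>
    have hp : 1 ≤ 2 ^ j := Nat.one_le_two_pow
    rw [pow_succ] at h
    rw [laterRounds, pairingRound_spine d _ l R (by omega), laterPrefix, ih]
    rw [length_pairPrefix d _ l (by omega)]
    omega

/-- The round that starts from `2 ^ (j + 1) - 2` nodes leaves `2 ^ j - 1`, one more than later
rounds use; that last node joins the inert tail. At `j = 0` truncated subtraction gives length 0. -/
lemma laterPrefix_append (d : Dir) (j : ℕ) (l l' : List (α × BinaryTree α))
    (h : l.length = 2 ^ j - 2) : laterPrefix d j (l ++ l') = laterPrefix d j l ++ l' := by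
  induction j generalizing l l' with
  | zero => rfl
  | succ j ih =>
    have hp : 1 ≤ 2 ^ j := Nat.one_le_two_pow
    rw [pow_succ] at h
    have hl : l.length = 2 * (2 ^ j - 1) := by omega
    have hlen := length_pairPrefix d (2 ^ j - 1) l (by omega)
    set v := pairPrefix d (2 ^ j - 1) l with hv
    have ht : (v.take (2 ^ j - 2)).length = 2 ^ j - 2 := by rw [List.length_take]; omega
    rw [laterPrefix, laterPrefix, pairPrefix_append d _ l l' hl, ← hv]
    conv_lhs => rw [← List.take_append_drop (2 ^ j - 2) v, List.append_assoc, ih _ _ ht]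
    conv_rhs => rw [← List.take_append_drop (2 ^ j - 2) v, ih _ _ ht]
    rw [List.append_assoc]

lemma potential_laterPrefix (d : Dir) (j : ℕ) (l : List (α × BinaryTree α)) (R : BinaryTree α)
    (h : l.length = 2 ^ j - 2) :
    potential (spine d (laterPrefix d j l) R) - potential (spine d l R)
      = laterCost j R.numNodes (sizes l) := by
  induction j generalizing l R with
  | zero => simp [laterPrefix, laterCost]
  | succ j ih =>
    have hp : 1 ≤ 2 ^ j := Nat.one_le_two_pow
    rw [pow_succ] at h
    have hl : l.length = 2 * (2 ^ j - 1) := by omega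
    have hlen := length_pairPrefix d (2 ^ j - 1) l (by omega)
    have h1 := potential_pairPrefix d _ l R hl
    have hs := sizes_pairPrefix d _ l hl
    rw [laterPrefix, laterCost, ← h1, ← hs]
    set v := pairPrefix d (2 ^ j - 1) l
    have ht : (v.take (2 ^ j - 2)).length = 2 ^ j - 2 := by rw [List.length_take]; omega
    have h2 := ih (v.take (2 ^ j - 2)) (spine d (v.drop (2 ^ j - 2)) R) ht
    rw [← spine_append, ← spine_append, ← laterPrefix_append d j _ _ ht,
      List.take_append_drop, numNodes_spine] at h2
    have e1 : sizes (v.take (2 ^ j - 2)) = (sizes v).take (2 ^ j - 2) := by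
      simp only [sizes, List.map_take]
    have e2 : sizes (v.drop (2 ^ j - 2)) = (sizes v).drop (2 ^ j - 2) := by
      simp only [sizes, List.map_drop]
    rw [e1, e2] at h2
    linarith

/-! ### The multipass transformation of a spine -/

/-- The multipass transformation on a list of nodes with hanging subtrees. -/
def multipassList (d : Dir) (l : List (α × BinaryTree α)) : List (α × BinaryTree α) :=
  laterPrefix d (Nat.log 2 (l.length + 1))
    (pairPrefix d (l.length - (2 ^ Nat.log 2 (l.length + 1) - 1)) l)

lemma two_pow_log_succ_bounds (k : ℕ) :
    2 ^ Nat.log 2 (k + 1) ≤ k + 1 ∧ k + 2 ≤ 2 * 2 ^ Nat.log 2 (k + 1) := by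
  have h1 := Nat.pow_log_le_self 2 (x := k + 1) (by omega)
  have h2 := Nat.lt_pow_succ_log_self (b := 2) (by norm_num) (k + 1)
  rw [Nat.pow_succ] at h2
  omega

lemma multipass_spine (d : Dir) (l : List (α × BinaryTree α)) (R : BinaryTree α) :
    multipass d l.length (spine d l R) = spine d (multipassList d l) R := by
  obtain ⟨h1, h2⟩ := two_pow_log_succ_bounds l.length
  rw [multipass, pairingRound_spine d _ l R (by omega), laterRounds_spine, multipassList]
  rw [length_pairPrefix d _ l (by omega)]
  omega

/-- `complete` on a list of nodes with hanging subtrees. -/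
def completeList (l : List (α × BinaryTree α)) : List (Option α × BinaryTree (Option α)) :=
  l.map fun p => (some p.1, complete p.2)

lemma complete_mkNode (d : Dir) (x : α) (A C : BinaryTree α) :
    complete (mkNode d x A C) = mkNode d (some x) (complete A) (complete C) := by
  cases d <;> rfl

lemma complete_spine (d : Dir) (l : List (α × BinaryTree α)) (R : BinaryTree α) :
    complete (spine d l R) = spine d (completeList l) (complete R) := by
  induction l with
  | nil => rfl
  | cons p l ih => simp only [spine, complete_mkNode, ih, completeList, List.map_cons]

lemma completeList_pairPrefix (d : Dir) (m : ℕ) (l : List (α × BinaryTree α)) :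
    completeList (pairPrefix d m l) = pairPrefix d m (completeList l) := by
  induction m generalizing l with
  | zero => rfl
  | succ m ih =>
    match l with
    | p :: p' :: l =>
      have := ih l
      simp only [completeList, pairPrefix, List.map_cons, complete_mkNode] at this ⊢
      rw [this]
    | [_] => rfl
    | [] => rfl

lemma completeList_laterPrefix (d : Dir) (j : ℕ) (l : List (α × BinaryTree α)) :
    completeList (laterPrefix d j l) = laterPrefix d j (completeList l) := by
  induction j generalizing l with
  | zero => rfl
  | succ j ih => rw [laterPrefix, ih, completeList_pairPrefix, laterPrefix]

lemma completeList_multipassList (d : Dir) (l : List (α × BinaryTree α)) :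
    completeList (multipassList d l) = multipassList d (completeList l) := by
  have : (completeList l).length = l.length := List.length_map _
  rw [multipassList, multipassList, completeList_laterPrefix, completeList_pairPrefix, this]

lemma numNodes_complete (t : BinaryTree α) : (complete t).numNodes = 2 * t.numNodes + 1 := by
  induction t with
  | nil => rfl
  | node a l r hl hr => simp only [complete, BinaryTree.numNodes, hl, hr]; ring

lemma pathSize_sizes_pairPrefix (d : Dir) (m c : ℕ) (l : List (α × BinaryTree α)) :
    pathSize c (sizes (pairPrefix d m l)) = pathSize c (sizes l) := by
  induction m generalizing l with
  | zero => rfl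
  | succ m ih =>
    match l with
    | p :: p' :: l =>
      have := ih l
      simp only [sizes, pairPrefix, List.map_cons, numNodes_mkNode, pathSize] at this ⊢
      rw [this]; ring
    | [_] => rfl
    | [] => rfl

lemma pathSize_sizes_laterPrefix (d : Dir) (j c : ℕ) (l : List (α × BinaryTree α)) :
    pathSize c (sizes (laterPrefix d j l)) = pathSize c (sizes l) := by
  induction j generalizing l with
  | zero => rfl
  | succ j ih => rw [laterPrefix, ih, pathSize_sizes_pairPrefix]

lemma numNodes_spine_multipassList (d : Dir) (l : List (α × BinaryTree α)) (R : BinaryTree α) :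
    (spine d (multipassList d l) R).numNodes = (spine d l R).numNodes := by
  rw [numNodes_spine, numNodes_spine, multipassList, pathSize_sizes_laterPrefix,
    pathSize_sizes_pairPrefix]

lemma dropLast_take_pos {w : List ℕ} (h : ∀ a ∈ w.dropLast, 0 < a) (i : ℕ) :
    ∀ a ∈ (w.take i).dropLast, 0 < a := by
  intro a ha
  apply h a
  rw [List.dropLast_eq_take, List.take_take, List.length_take] at ha
  rw [List.dropLast_eq_take]
  exact (List.take_subset_take_left w (by omega)) ha

/-- After the first round only the last hanging subtree can be empty. -/
lemma pairUp_dropLast_pos (m : ℕ) (w : List ℕ) (hm : w.length = 2 * m)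
    (h : ∀ a ∈ w.dropLast, 0 < a) : ∀ a ∈ pairUp w, 0 < a := by
  induction m generalizing w with
  | zero => obtain rfl : w = [] := by simpa using hm
            simp [pairUp]
  | succ m ih =>
    match w, hm with
    | [_], h => simp at h; omega
    | [], h => simp at h
    | a :: b :: w, hm =>
      simp only [pairUp, List.mem_cons, forall_eq_or_imp]
      refine ⟨by omega, ih w (by simp at hm; omega) fun x hx => h x ?_⟩
      rcases w with _ | ⟨y, w⟩
      · simp at hx
      · simp only [List.dropLast_cons_cons, List.mem_cons] at hx ⊢
        tauto

/-- The multipass transformation of a path whose hanging subtrees, except possibly the last one,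
are nonempty. -/
theorem exists_potential_multipassList_le : ∃ C : ℝ, 0 ≤ C ∧
    ∀ (α : Type*) (d : Dir) (l : List (α × BinaryTree α)) (R : BinaryTree α) (n : ℕ), 2 ≤ n →
      (spine d l R).numNodes ≤ 2 * n + 1 → (∀ a ∈ (sizes l).dropLast, 0 < a) →
      potential (spine d (multipassList d l) R) - potential (spine d l R)
        ≤ -((l.length : ℝ) / 2 ^ logStar n) + C * (Real.logb 2 n * logStar n) := by
  obtain ⟨C₁, hC₁, hlink⟩ := exists_linkDelta_le
  obtain ⟨C₂, hC₂, hlater⟩ := exists_laterCost_le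
  -- The 3 comes from `2n + 2 ≤ n ^ 3`. The summand `C₁ + 1` pays for the first round, whose last
  -- rotation may meet an empty subtree.
  refine ⟨3 * (C₁ + 1 + C₂), by linarith, fun α d l R n hn hsize hpos => ?_⟩
  obtain ⟨hlo, hhi⟩ := two_pow_log_succ_bounds l.length
  have hj : multipassList d l = laterPrefix d (Nat.log 2 (l.length + 1))
    (pairPrefix d (l.length - (2 ^ Nat.log 2 (l.length + 1) - 1)) l) := rfl
  set j := Nat.log 2 (l.length + 1)
  obtain ⟨m, hm⟩ : ∃ m, m = l.length - (2 ^ j - 1) := ⟨_, rfl⟩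
  rw [hj, ← hm]
  have hp : 1 ≤ 2 ^ j := Nat.one_le_two_pow
  have hm2 : 2 * m ≤ l.length := by omega
  set l₁ := l.take (2 * m) with hl₁
  set l₂ := l.drop (2 * m) with hl₂
  have hll : l = l₁ ++ l₂ := (List.take_append_drop _ _).symm
  have hlen₁ : l₁.length = 2 * m := by rw [hl₁, List.length_take]; omega
  have hsz₁ : sizes l₁ = (sizes l).take (2 * m) := by simp only [hl₁, sizes, List.map_take]
  have hsz₂ : sizes l₂ = (sizes l).drop (2 * m) := by simp only [hl₂, sizes, List.map_drop]
  have hszl : (sizes l).length = l.length := List.length_map _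
  -- the first round
  have hpair : pairPrefix d m l = pairPrefix d m l₁ ++ l₂ := by
    conv_lhs => rw [hll, pairPrefix_append d m l₁ l₂ hlen₁]
  have hfirst : potential (spine d (pairPrefix d m l) R) - potential (spine d l R)
      = roundCost (spine d l₂ R).numNodes (sizes l₁) := by
    rw [hpair, spine_append]
    conv_lhs => rw [hll]
    rw [spine_append, potential_pairPrefix d m l₁ _ hlen₁]
  have hfirst_le := roundCost_le_of_dropLast hlink hC₁ (spine d l₂ R).numNodes (sizes l₁)
    (by rw [hsz₁]; exact dropLast_take_pos hpos _)
  rw [← numNodes_spine d, ← spine_append, ← hll, ← hfirst] at hfirst_le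
  -- the later rounds
  set v := pairPrefix d m l with hv
  have hvlen : v.length = 2 ^ j - 1 := by rw [hv, length_pairPrefix d m l hm2]; omega
  have ht : (v.take (2 ^ j - 2)).length = 2 ^ j - 2 := by rw [List.length_take]; omega
  have hvpos : ∀ a ∈ (sizes v).dropLast, 0 < a := by
    have e : sizes v = pairUp (sizes l₁) ++ sizes l₂ := by
      rw [hpair, ← sizes_pairPrefix d m l₁ hlen₁]; simp [sizes]
    have h1 := pairUp_dropLast_pos m (sizes l₁) (by simp [sizes, hlen₁])
      (by rw [hsz₁]; exact dropLast_take_pos hpos _)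
    intro a ha
    rw [e] at ha
    rcases eq_or_ne (sizes l₂) [] with h | h
    · rw [h, List.append_nil] at ha
      exact h1 a (List.mem_of_mem_dropLast ha)
    · rw [List.dropLast_append_of_ne_nil h, List.mem_append] at ha
      rcases ha with ha | ha
      · exact h1 a ha
      · apply hpos a
        have e2 : sizes l = sizes l₁ ++ sizes l₂ := by rw [hsz₁, hsz₂, List.take_append_drop]
        rw [e2, List.dropLast_append_of_ne_nil h, List.mem_append]
        exact Or.inr ha
  have hround : IsRoundList j (sizes (v.take (2 ^ j - 2))) := by
    refine ⟨(List.length_map _).trans ht, fun a ha => hvpos a ?_⟩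
    -- The later rounds never touch the last of the `2 ^ j - 1` nodes, the only one whose hanging
    -- subtree may be empty.
    have e : sizes (v.take (2 ^ j - 2)) = (sizes v).dropLast := by
      have : (sizes v).length = 2 ^ j - 1 := by rw [← hvlen]; exact List.length_map _
      rw [List.dropLast_eq_take, this, sizes, List.map_take, ← sizes]
      rfl
    rwa [← e]
  have hsizev : (spine d v R).numNodes = (spine d l R).numNodes := by
    rw [numNodes_spine, numNodes_spine, hv, pathSize_sizes_pairPrefix]
  have hsplit : spine d (v.take (2 ^ j - 2)) (spine d (v.drop (2 ^ j - 2)) R) = spine d v R := by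
    rw [← spine_append, List.take_append_drop]
  have hl := potential_laterPrefix d j (v.take (2 ^ j - 2)) (spine d (v.drop (2 ^ j - 2)) R) ht
  rw [hsplit, ← spine_append, ← laterPrefix_append d j _ _ ht, List.take_append_drop] at hl
  have hl_le := hlater n j _ _ hn hround
    (by rw [← numNodes_spine d, hsplit, hsizev]; exact hsize)
  rw [← hl] at hl_le
  -- conversion of the constants
  have hn' : (2 : ℝ) ≤ n := by exact_mod_cast hn
  have hr : (1 : ℝ) ≤ logStar n := by exact_mod_cast one_le_logStar (x := n) (by linarith)
  have hlog : 1 ≤ Real.logb 2 n := by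
    rw [Real.le_logb_iff_rpow_le (by norm_num) (by linarith)]; simpa using hn'
  have hlev : level (2 * n + 1) ≤ 3 * Real.logb 2 n := by
    have : Real.logb 2 ((n : ℝ) ^ 3) = 3 * Real.logb 2 n := by
      rw [Real.logb_pow]; norm_num
    rw [← this]
    refine logb_two_mono (by positivity) ?_
    push_cast
    nlinarith [mul_le_mul hn' hn' (by norm_num) (by linarith)]
  have hlev' : level (spine d l R).numNodes ≤ 3 * Real.logb 2 n := (level_mono hsize).trans hlev
  have hlevr : level (2 * n + 1) * logStar n ≤ 3 * (Real.logb 2 n * logStar n) := by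
    rw [← mul_assoc]; gcongr
  have hlogr : Real.logb 2 n ≤ Real.logb 2 n * logStar n :=
    le_mul_of_one_le_right (by linarith) hr
  -- The first round may halve the path; the factor 2 in the later gain compensates for it.
  have hk : (l.length : ℝ) / 2 ^ logStar n ≤ 2 * 2 ^ j / 2 ^ logStar n := by
    have : (l.length : ℝ) ≤ 2 * 2 ^ j := by exact_mod_cast (by omega : l.length ≤ 2 * 2 ^ j)
    gcongr
  have h1 : C₁ * level (spine d l R).numNodes ≤ C₁ * (3 * (Real.logb 2 n * logStar n)) := by
    gcongr; linarith
  have h2 := mul_le_mul_of_nonneg_left hlevr hC₂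
  linarith

/-! ### Positions -/

lemma subtreeAt_nil (p : List Dir) : subtreeAt (.nil : BinaryTree α) p = .nil := by
  cases p <;> rfl

lemma subtreeAt_append (t : BinaryTree α) (p p' : List Dir) :
    subtreeAt t (p ++ p') = subtreeAt (subtreeAt t p) p' := by
  induction p generalizing t with
  | nil => cases t <;> rfl
  | cons e p ih =>
    cases t with
    | nil => simp only [subtreeAt_nil]
    | node a l r => cases e <;> exact ih _

lemma subtreeAt_mkNode (d : Dir) (x : α) (A C : BinaryTree α) (p : List Dir) :
    subtreeAt (mkNode d x A C) (d :: p) = subtreeAt C p := by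
  cases d <;> rfl

lemma subtreeAt_mkNode_opp (d : Dir) (x : α) (A C : BinaryTree α) (p : List Dir) :
    subtreeAt (mkNode d x A C) (d.opp :: p) = subtreeAt A p := by
  cases d <;> rfl

lemma exists_mkNode (d : Dir) {t : BinaryTree α} (h : t ≠ .nil) : ∃ x A C, t = mkNode d x A C := by
  cases t with
  | nil => exact absurd rfl h
  | node a l r =>
    cases d
    exacts [⟨a, r, l, rfl⟩, ⟨a, l, r, rfl⟩]

lemma exists_spine (d : Dir) (k : ℕ) (t : BinaryTree α)
    (h : ∀ i < k, subtreeAt t (List.replicate i d) ≠ .nil) :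
    ∃ l R, l.length = k ∧ t = spine d l R := by
  induction k generalizing t with
  | zero => exact ⟨[], t, rfl, rfl⟩
  | succ k ih =>
    obtain ⟨x, A, C, rfl⟩ := exists_mkNode d (t := t) fun h0 => h 0 (by omega) (by subst h0; rfl)
    obtain ⟨l, R, hl, rfl⟩ := ih C fun i hi => by
      have := h (i + 1) (by omega)
      rwa [List.replicate_succ, subtreeAt_mkNode] at this
    exact ⟨(x, A) :: l, R, by simp [hl], rfl⟩

lemma sizes_dropLast_pos (d : Dir) (l : List (α × BinaryTree α)) (R : BinaryTree α)
    (h : ∀ i, i + 1 < l.length → subtreeAt (spine d l R) (List.replicate i d ++ [d.opp]) ≠ .nil) :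
    ∀ a ∈ (sizes l).dropLast, 0 < a := by
  induction l with
  | nil => simp [sizes]
  | cons p l ih =>
    rcases l with _ | ⟨p', l⟩
    · simp [sizes]
    · simp only [sizes, List.map_cons, List.dropLast_cons_cons, List.mem_cons,
        forall_eq_or_imp] at ih ⊢
      refine ⟨?_, ih fun i hi => ?_⟩
      · have := h 0 (by simp)
        rw [List.replicate_zero, List.nil_append, spine, subtreeAt_mkNode_opp] at this
        rcases hp : p.2 with _ | ⟨a, b, c⟩
        · exact absurd (by rw [hp]; rfl) this
        · simp [BinaryTree.numNodes]
      · have := h (i + 1) (by simpa using hi)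
        rwa [List.replicate_succ, List.cons_append, spine, subtreeAt_mkNode] at this

lemma numNodes_modifyAt (f : BinaryTree α → BinaryTree α) (t : BinaryTree α) (q : List Dir)
    (h : (f (subtreeAt t q)).numNodes = (subtreeAt t q).numNodes) :
    (modifyAt f t q).numNodes = t.numNodes := by
  induction q generalizing t with
  | nil => cases t <;> exact h
  | cons e q ih =>
    cases t with
    | nil => rfl
    | node a l r =>
      cases e
      · have := ih l h
        simp only [modifyAt, BinaryTree.numNodes, this]
      · have := ih r h
        simp only [modifyAt, BinaryTree.numNodes, this]

/-- Sizes outside the replaced subtree are unchanged, so the change of the potential is local. -/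
lemma potential_modifyAt (f : BinaryTree α → BinaryTree α) (t : BinaryTree α) (q : List Dir)
    (hne : subtreeAt t q ≠ .nil)
    (h : (f (subtreeAt t q)).numNodes = (subtreeAt t q).numNodes) :
    potential (modifyAt f t q) - potential t
      = potential (f (subtreeAt t q)) - potential (subtreeAt t q) := by
  induction q generalizing t with
  | nil => cases t <;> rfl
  | cons e q ih =>
    cases t with
    | nil => exact absurd rfl hne
    | node a l r =>
      cases e
      · have h1 := ih l hne h
        have h2 := numNodes_modifyAt f l q h
        simp only [modifyAt, potential_node, h2, subtreeAt]
        linarith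
      · have h1 := ih r hne h
        have h2 := numNodes_modifyAt f r q h
        simp only [modifyAt, potential_node, h2, subtreeAt]
        linarith

lemma subtreeAt_complete (t : BinaryTree α) (q : List Dir) (hne : subtreeAt t q ≠ .nil) :
    subtreeAt (complete t) q = complete (subtreeAt t q) := by
  induction q generalizing t with
  | nil => cases t <;> rfl
  | cons e q ih =>
    cases t with
    | nil => exact absurd rfl hne
    | node a l r => cases e <;> exact ih _ hne

/-- Completion changes the label type, so `f` does not act on the completed tree; a constant
function inserts the completed result. -/
lemma complete_modifyAt (f : BinaryTree α → BinaryTree α) (t : BinaryTree α) (q : List Dir)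
    (hne : subtreeAt t q ≠ .nil) :
    complete (modifyAt f t q)
      = modifyAt (fun _ => complete (f (subtreeAt t q))) (complete t) q := by
  induction q generalizing t with
  | nil => cases t <;> rfl
  | cons e q ih =>
    cases t with
    | nil => exact absurd rfl hne
    | node a l r =>
      cases e
      · simp only [modifyAt, complete, ih l hne, subtreeAt]
      · simp only [modifyAt, complete, ih r hne, subtreeAt]

end Multipass

theorem theorem3 :
    ∃ C : ℝ, ∀ (α : Type*) (t : BinaryTree α) (q : List Dir) (d : Dir) (k n : ℕ),
      IsMonotonePath t q d k →
      n = (subtreeAt t q).numNodes →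
      2 ≤ n →
        -- sizes count the nodes of the tree
        ((∀ i, i + 1 < k → subtreeAt t (pathPos q d i ++ [d.opp]) ≠ .nil) →
          potential (modifyAt (multipass d k) t q) - potential t
            ≤ -((k : ℝ) / 2 ^ logStar n) + C * (Real.logb 2 n * logStar n)) ∧
        -- empty subtrees count as leaves
        (potential (complete (modifyAt (multipass d k) t q)) - potential (complete t)
            ≤ -((k : ℝ) / 2 ^ logStar n) + C * (Real.logb 2 n * logStar n)) := by
  obtain ⟨C, -, hC⟩ := exists_potential_multipassList_le
  refine ⟨C, fun α t q d k n hpath hn hn2 => ?_⟩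
  have hne : subtreeAt t q ≠ .nil := by
    intro h
    rw [h] at hn
    simp only [BinaryTree.numNodes] at hn
    omega
  obtain ⟨l, R, rfl, hlR⟩ := exists_spine d k (subtreeAt t q) fun i hi => by
    have := hpath i hi
    rwa [pathPos, subtreeAt_append] at this
  have hnum : (multipass d l.length (subtreeAt t q)).numNodes = (subtreeAt t q).numNodes := by
    rw [hlR, multipass_spine, numNodes_spine_multipassList]
  constructor
  · intro hhang
    rw [potential_modifyAt _ _ _ hne hnum, hlR, multipass_spine]
    refine hC α d l R n hn2 (by rw [← hlR]; omega) (sizes_dropLast_pos d l R fun i hi => ?_)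
    have := hhang i hi
    rwa [pathPos, List.append_assoc, subtreeAt_append, hlR] at this
  · have hsub := subtreeAt_complete t q hne
    rw [complete_modifyAt _ _ _ hne, potential_modifyAt, hsub, hlR, multipass_spine,
      complete_spine, complete_spine, completeList_multipassList]
    · have hlen : (completeList l).length = l.length := List.length_map _
      rw [← hlen]
      -- A completed subtree has `2n + 1` nodes, which is why the size bound has this form, and no
      -- completed hanging subtree is empty.
      refine hC (Option α) d (completeList l) (complete R) n hn2 ?_ fun a ha => ?_
      · rw [← complete_spine, ← hlR, numNodes_complete]; omega
      · have := List.mem_of_mem_dropLast ha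
        simp only [sizes, completeList, List.map_map, List.mem_map, Function.comp] at this
        obtain ⟨p, -, rfl⟩ := this
        rw [numNodes_complete]; omega
    · rw [hsub]
      intro h
      have := congrArg BinaryTree.numNodes h
      rw [numNodes_complete] at this
      simp [BinaryTree.numNodes] at this
    · rw [hsub, numNodes_complete, numNodes_complete, hnum]
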